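/- **Setup.** Let $d\ge 1$, $k,L,n_0,m\ge 0$ be integers, let $(x)_{x\in\mathcal X}$ be a finite family of inputs $x=(x_{i,\alpha})\in\mathbb R^{n_0\times d}$, with pixels $\alpha$ indexed by $\mathbb Z/d$ (circular padding), let $v_\beta\ge 0$ for $\beta\in\{-k,\dots,k\}$ with $\sum_\beta v_\beta=1$, and let $\sigma_\omega,\sigma_b\ge 0$. Let $\phi:\mathbb R\to\mathbb R$ be absolutely continuous (on every compact interval) with exponentially bounded derivative: there are $a,b\in\mathbb R$ with $|\phi'(u)|\le a\,e^{b|u|}$ for almost every $u$. For each $t\in\mathbb N$ let $n^0(t)=n_0,\ n^1(t),\dots,n^L(t),\ n^{L+1}(t)=m$ be the layer widths of a convolutional network whose weights $\omega^l_{ij,\beta}$ and biases $b^l_i$ ($0\le l\le L$, $1\le i\le n^{l+1}(t)$, $1\le j\le n^l(t)$, $|\beta|\le k$) are jointly independent random variables with $\omega^l_{ij,\beta}\sim\mathcal N(0,v_\beta\sigma_\omega^2/n^l(t))$ and $b^l_i\sim\mathcal N(0,\sigma_b^2)$. For an input $x$ put $y^0_{i,\alpha}(x)=x_{i,\alpha}$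 and $$z^l_{i,\alpha}(x)=\sum_{j=1}^{n^l(t)}\sum_{\beta=-k}^{k}\omega^l_{ij,\beta}\,y^l_{j,\alpha+\beta}(x)+b^l_i,\qquad y^{l+1}_{i,\alpha}(x)=\phi\big(z^l_{i,\alpha}(x)\big).$$ For matrices $K$ indexed by $(\mathcal X\times\mathbb Z/d)^2$ define $$[\mathcal A(K)]_{\alpha,\alpha'}(x,x')=\sigma_b^2+\sigma_\omega^2\sum_{\beta=-k}^k v_\beta\,[K]_{\alpha+\beta,\alpha'+\beta}(x,x'),$$ $$[\mathcal C(K)]_{\alpha,\alpha'}(x,x')=\mathbb E_{u\sim\mathcal N(0,K)}\big[\phi(u_\alpha(x))\,\phi(u_{\alpha'}(x'))\big]\quad(K\text{ positive semidefinite}),$$ $$[K^0]_{\alpha,\alpha'}(x,x')=\frac1{n_0}\sum_{i=1}^{n_0}x_{i,\alpha}x'_{i,\alpha'},\qquad K^l_\infty=(\mathcal C\circ\mathcal A)^l(K^0)$$ (with $K^0=0$ if $n_0=0$). **Theorem.** The kernels $K^l_\infty$, $0\le l\le L$, are well defined: $K^l_\infty$ and $\mathcal A(K^l_\infty)$ are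 positive semidefinite for $l\le L$, and the expectations defining $\mathcal C(\mathcal A(K^l_\infty))$ converge absolutely for $l<L$. If $\min\{n^1(t),\dots,n^L(t)\}\to\infty$ as $t\to\infty$ (no condition if $L=0$), then the vector $z^L=(z^L_{i,\alpha}(x))_{x\in\mathcal X,\,\alpha\in\mathbb Z/d,\,1\le i\le m}$ of top-layer pre-activations converges in distribution: $$z^L\ \xrightarrow[t\to\infty]{\mathcal D}\ \mathcal N\big(0,\ \mathcal A(K^L_\infty)\otimes I_m\big).$$ -/

import Mathlib

open MeasureTheory ProbabilityTheory Filter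
open scoped Topology NNReal Kronecker

noncomputable section

namespace CNN

/-- The filter locations `{-k, …, 0, …, k}`. -/
def offsets (k : ℕ) : Finset ℤ := Finset.Icc (-(k : ℤ)) (k : ℤ)

/-- `φ` is absolutely continuous, i.e. absolutely continuous on every compact interval. -/
def IsAbsolutelyContinuous (φ : ℝ → ℝ) : Prop :=
  ∀ a b : ℝ, AbsolutelyContinuousOnInterval φ a b

/-- `f` is exponentially bounded almost everywhere. -/
def IsExpBounded (f : ℝ → ℝ) : Prop :=
  ∃ a b : ℝ, ∀ᵐ u ∂(volume : Measure ℝ), |f u| ≤ a * Real.exp (b * |u|)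

/-! ### The network -/

section Network

variable {d : ℕ}

/-- An input image with `n₀` channels and `d` pixels, as a function on all channel indices.
Only the channels `j < n₀` are ever used. -/
def inputLayer {n₀ : ℕ} (x : Fin n₀ → ZMod d → ℝ) : ℕ → ZMod d → ℝ :=
  fun j α => if h : j < n₀ then x ⟨j, h⟩ α else 0

/-- One convolutional layer with `m` incoming channels, filter `w i j β` and bias `b i`.
Pixels live in `ZMod d`, so that the padding is circular. -/
def conv (k m : ℕ) (w : ℕ → ℕ → ℤ → ℝ) (b : ℕ → ℝ) (y : ℕ → ZMod d → ℝ) : ℕ → ZMod d → ℝ :=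
  fun i α => (∑ j ∈ Finset.range m, ∑ β ∈ offsets k, w i j β * y j (α + (β : ZMod d))) + b i

/-- The activations `y^l`: layer `0` is the input `y₀`, and `y^{l+1} = φ (z^l)`, where `z^l` is
the convolution of `y^l`. The width of layer `l` is `n l`. -/
def activation (φ : ℝ → ℝ) (k : ℕ) (n : ℕ → ℕ) (w : ℕ → ℕ → ℕ → ℤ → ℝ) (b : ℕ → ℕ → ℝ)
    (y₀ : ℕ → ZMod d → ℝ) : ℕ → ℕ → ZMod d → ℝ
  | 0 => y₀
  | l + 1 => fun i α => φ (conv k (n l) (w l) (b l) (activation φ k n w b y₀ l) i α)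

/-- The pre-activations `z^l`. -/
def preactivation (φ : ℝ → ℝ) (k : ℕ) (n : ℕ → ℕ) (w : ℕ → ℕ → ℕ → ℤ → ℝ) (b : ℕ → ℕ → ℝ)
    (y₀ : ℕ → ZMod d → ℝ) (l : ℕ) : ℕ → ZMod d → ℝ :=
  conv k (n l) (w l) (b l) (activation φ k n w b y₀ l)

end Network

/-! ### The prior on the parameters -/

/-- Indices `(l, i, j, β)` of the weights of a network with layers `0, …, L` and widths `n`. -/
abbrev WeightIndex (L k : ℕ) (n : ℕ → ℕ) : Type :=
  (l : Fin (L + 1)) × (Fin (n (l + 1)) × Fin (n l) × {β : ℤ // β ∈ offsets k})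

/-- Indices `(l, i)` of the biases of a network with layers `0, …, L` and widths `n`. -/
abbrev BiasIndex (L : ℕ) (n : ℕ → ℕ) : Type :=
  (l : Fin (L + 1)) × Fin (n (l + 1))

/-- The family of all parameters (weights and biases) of the network, as random variables. -/
def paramFamily {Ω : Type*} (L k : ℕ) (n : ℕ → ℕ)
    (w : ℕ → ℕ → ℕ → ℤ → Ω → ℝ) (b : ℕ → ℕ → Ω → ℝ) :
    WeightIndex L k n ⊕ BiasIndex L n → Ω → ℝ
  | Sum.inl ⟨l, i, j, β⟩ => w l i j β
  | Sum.inr ⟨l, i⟩ => b l i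

/-- The parameters of the network are independent, the weight `w^l_{ij,β}` has law
`N(0, v_β σ_w² / n^l)` and the bias `b^l_i` has law `N(0, σ_b²)`. -/
structure IsGaussianPrior {Ω : Type*} [MeasurableSpace Ω] (P : Measure Ω) (L k : ℕ) (n : ℕ → ℕ)
    (v : ℤ → ℝ≥0) (σw σb : ℝ≥0)
    (w : ℕ → ℕ → ℕ → ℤ → Ω → ℝ) (b : ℕ → ℕ → Ω → ℝ) : Prop where
  weight_law : ∀ l ≤ L, ∀ i < n (l + 1), ∀ j < n l, ∀ β ∈ offsets k,
    HasLaw (w l i j β) (gaussianReal 0 (v β * (σw ^ 2 / (n l : ℝ≥0)))) P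
  bias_law : ∀ l ≤ L, ∀ i < n (l + 1), HasLaw (b l i) (gaussianReal 0 (σb ^ 2)) P
  indep : iIndepFun (paramFamily L k n w b) P

/-! ### The compositional kernel -/

section Kernel

variable {𝒳 : Type*} {d : ℕ}

/-- The uncentered covariance `K⁰` of the inputs. -/
def inputCov {n₀ : ℕ} (x : 𝒳 → Fin n₀ → ZMod d → ℝ) : Matrix (𝒳 × ZMod d) (𝒳 × ZMod d) ℝ :=
  Matrix.of fun p q => (1 / (n₀ : ℝ)) * ∑ i : Fin n₀, x p.1 i p.2 * x q.1 i q.2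

/-- The affine map `𝒜`:
`[𝒜 K]_{α,α'}(x,x') = σ_b² + σ_w² ∑_β v_β [K]_{α+β,α'+β}(x,x')`. -/
def affineMap (k : ℕ) (v : ℤ → ℝ≥0) (σw σb : ℝ≥0) (K : Matrix (𝒳 × ZMod d) (𝒳 × ZMod d) ℝ) :
    Matrix (𝒳 × ZMod d) (𝒳 × ZMod d) ℝ :=
  Matrix.of fun p q => (σb : ℝ) ^ 2 + (σw : ℝ) ^ 2 *
    ∑ β ∈ offsets k, (v β : ℝ) * K (p.1, p.2 + (β : ZMod d)) (q.1, q.2 + (β : ZMod d))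

/-- The map `𝒞`: `[𝒞 K]_{α,α'}(x,x') = 𝔼 [φ(u_α(x)) φ(u_{α'}(x'))]` for `u ∼ N(0, K)`. -/
def covMap [Fintype 𝒳] [DecidableEq 𝒳] [NeZero d] (φ : ℝ → ℝ)
    (K : Matrix (𝒳 × ZMod d) (𝒳 × ZMod d) ℝ) : Matrix (𝒳 × ZMod d) (𝒳 × ZMod d) ℝ :=
  Matrix.of fun p q => ∫ u, φ (u p) * φ (u q) ∂(multivariateGaussian 0 K)

/-- The compositional kernel `K_∞^l = (𝒞 ∘ 𝒜)^l (K⁰)`. -/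
def limitKernel [Fintype 𝒳] [DecidableEq 𝒳] [NeZero d] (φ : ℝ → ℝ) (k : ℕ) (v : ℤ → ℝ≥0)
    (σw σb : ℝ≥0) {n₀ : ℕ} (x : 𝒳 → Fin n₀ → ZMod d → ℝ) (l : ℕ) :
    Matrix (𝒳 × ZMod d) (𝒳 × ZMod d) ℝ :=
  (covMap φ ∘ affineMap k v σw σb)^[l] (inputCov x)

end Kernel

/-- The vector of all top-layer pre-activations `z^L_{i,α}(x)`, `i < m`, on all inputs,
for the parameters `w`, `b`. -/
def topPreactivation {𝒳 : Type*} {d n₀ : ℕ} (φ : ℝ → ℝ) (k L m : ℕ) (n : ℕ → ℕ)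
    (x : 𝒳 → Fin n₀ → ZMod d → ℝ) (w : ℕ → ℕ → ℕ → ℤ → ℝ) (b : ℕ → ℕ → ℝ) :
    EuclideanSpace ℝ ((𝒳 × ZMod d) × Fin m) :=
  WithLp.toLp 2 fun p =>
    preactivation φ k n w b (inputLayer (x p.1.1)) L (p.2 : ℕ) p.1.2

end CNN

end

/-!
The proof rests on one observation: given the activations `y^l` of layer `l`, the channels of the
pre-activation `z^l` are independent Gaussian vectors whose covariance is `𝒜 K`, where `K` is the
empirical covariance `(1 / n^l) ∑_j y^l_j y^l_jᵀ` (`map_layerOut`). All randomness of the earlier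
layers therefore enters only through the positive semidefinite matrix `K`, and it is enough to
prove that the empirical covariances converge in probability to the compositional kernel.

* This is shown by induction on the layer (`tendsto_measure_empiricalCov_notMem`). The empirical
  covariance of layer `l + 1` is an average of `n^{l+1}` conditionally independent terms
  `φ(z_p) φ(z_q)`, so Chebyshev's inequality places it near its conditional mean `𝒞 (𝒜 K)`. As `K`
  is random, this has to hold uniformly for `𝒜 K` near its limit (`exists_deviation_le`), which
  needs locally bounded second moments (`memLp_mul_eval`) and the continuity of `𝒞` on positive
  semidefinite matrices (`tendsto_integral_mul_eval`); the latter follows from Lévy's theorem and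
  a truncation. The only properties of `φ` that matter are its continuity and its exponential
  growth (`IsAbsolutelyContinuous.exists_abs_le_exp`).
* At the top layer the characteristic function of `z^L` is the expectation of
  `exp (-⟨s, (𝒜 K ⊗ I) s⟩ / 2)`, a function of `K` which is bounded by one and continuous
  (`charFun_map_flatten_layerOut`). Convergence in probability of `K` thus gives pointwise
  convergence of characteristic functions, and Lévy's theorem concludes.

Conditioning is Fubini's theorem: the activations of a layer are functions of the parameters of the
earlier layers, hence independent of the parameters of the layer
(`IsGaussianPrior.indepFun_layerActivation`). The parameters are replaced beforehand by measurable
modifications, so that they generate sub-σ-algebras.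
-/

namespace CNN

/-! ### Growth of the nonlinearity -/

lemma IsAbsolutelyContinuous.continuous {φ : ℝ → ℝ} (hφ : IsAbsolutelyContinuous φ) :
    Continuous φ := by
  refine continuous_iff_continuousAt.2 fun x => ?_
  refine (hφ (x - 1) (x + 1)).continuousOn.continuousAt ?_
  rw [Set.uIcc_of_le (by linarith)]
  exact Icc_mem_nhds (by linarith) (by linarith)

/-- By the fundamental theorem of calculus, an exponential bound on the derivative of an absolutely
continuous function integrates to an exponential bound on the function. -/
lemma IsAbsolutelyContinuous.exists_abs_le_exp {φ : ℝ → ℝ} (hφ : IsAbsolutelyContinuous φ)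
    (hφ' : IsExpBounded (deriv φ)) :
    ∃ A B : ℝ, ∀ u, |φ u| ≤ A * Real.exp (B * |u|) := by
  obtain ⟨a, b, hab⟩ := hφ'
  refine ⟨|φ 0| + |a|, |b| + 1, fun u => ?_⟩
  have h1 : ‖∫ x in (0 : ℝ)..u, deriv φ x‖ ≤ |a| * Real.exp (|b| * |u|) * |u - 0| := by
    refine intervalIntegral.norm_integral_le_of_norm_le_const_ae ?_
    filter_upwards [hab] with x hx hxu
    have hxu' : |x| ≤ |u| := by
      rcases Set.mem_uIoc.1 hxu with h | h
      · exact abs_le_abs_of_nonneg h.1.le h.2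
      · exact abs_le_abs_of_nonpos h.2 h.1.le
    calc ‖deriv φ x‖ ≤ a * Real.exp (b * |x|) := hx
      _ ≤ |a| * Real.exp (|b| * |u|) := by
        gcongr
        · exact le_abs_self a
        · exact le_abs_self b
  rw [(hφ 0 u).integral_deriv_eq_sub, sub_zero, Real.norm_eq_abs] at h1
  have h2 : |u| ≤ Real.exp |u| := by linarith [Real.add_one_le_exp |u|]
  have h3 : Real.exp ((|b| + 1) * |u|) = Real.exp (|b| * |u|) * Real.exp |u| := by
    rw [← Real.exp_add]; ring_nf
  have h4 : (1 : ℝ) ≤ Real.exp ((|b| + 1) * |u|) := Real.one_le_exp (by positivity)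
  calc |φ u| = |φ 0 + (φ u - φ 0)| := by ring_nf
    _ ≤ |φ 0| + |φ u - φ 0| := abs_add_le _ _
    _ ≤ |φ 0| * Real.exp ((|b| + 1) * |u|) + |a| * (Real.exp (|b| * |u|) * Real.exp |u|) := by
      refine add_le_add (le_mul_of_one_le_right (abs_nonneg _) h4) (h1.trans ?_)
      rw [mul_assoc]
      gcongr
    _ = _ := by rw [← h3]; ring

/-! ### Gaussian expectations as functions of the covariance -/

lemma abs_sub_clamp_le {x R : ℝ} (hR : 0 < R) : |x - max (-R) (min R x)| ≤ x ^ 2 / R := by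
  rw [le_div_iff₀ hR]
  rcases le_total x R with h | h
  · rw [min_eq_right h]
    rcases le_total (-R) x with h' | h'
    · rw [max_eq_right h', sub_self, abs_zero, zero_mul]; positivity
    · rw [max_eq_left h', abs_of_nonpos (by linarith)]; nlinarith
  · rw [min_eq_left h, max_eq_right (by linarith), abs_of_nonneg (by linarith)]; nlinarith

/-- Weak convergence passes to the integral of an unbounded continuous function whose second
moments are bounded: replacing `F` by its truncation at height `R` costs at most `C / R`. -/
lemma tendsto_integral_of_sq_bounded {X : Type*} [TopologicalSpace X] [MeasurableSpace X]
    [OpensMeasurableSpace X] {μ : ℕ → ProbabilityMeasure X} {μ₀ : ProbabilityMeasure X}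
    (hμ : Tendsto μ atTop (𝓝 μ₀)) {F : X → ℝ} (hF : Continuous F)
    (hL : ∀ n, MemLp F 2 (μ n : Measure X)) (hL₀ : MemLp F 2 (μ₀ : Measure X)) {C : ℝ}
    (hC : ∀ᶠ n in atTop, ∫ x, F x ^ 2 ∂(μ n : Measure X) ≤ C)
    (hC₀ : ∫ x, F x ^ 2 ∂(μ₀ : Measure X) ≤ C) :
    Tendsto (fun n => ∫ x, F x ∂(μ n : Measure X)) atTop (𝓝 (∫ x, F x ∂(μ₀ : Measure X))) := by
  have hC_nonneg : 0 ≤ C := (integral_nonneg fun x => sq_nonneg (F x)).trans hC₀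
  have key : ∀ (ν : ProbabilityMeasure X) (R : ℝ), 0 < R → MemLp F 2 (ν : Measure X) →
      ∫ x, F x ^ 2 ∂(ν : Measure X) ≤ C →
      |∫ x, F x ∂(ν : Measure X) - ∫ x, max (-R) (min R (F x)) ∂(ν : Measure X)| ≤ C / R := by
    intro ν R hR hν hνC
    have hi : Integrable F (ν : Measure X) := hν.integrable (by norm_num)
    have hi' : Integrable (fun x => max (-R) (min R (F x))) (ν : Measure X) := by
      refine Integrable.of_bound (C := R)
        (continuous_const.max (continuous_const.min hF)).aestronglyMeasurable (ae_of_all _ ?_)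
      intro x
      rw [Real.norm_eq_abs, abs_le]
      exact ⟨le_max_left _ _, max_le (by linarith) (min_le_left _ _)⟩
    rw [← integral_sub hi hi']
    calc |∫ x, (F x - max (-R) (min R (F x))) ∂(ν : Measure X)|
        ≤ ∫ x, F x ^ 2 / R ∂(ν : Measure X) :=
          norm_integral_le_of_norm_le (f := fun x => F x - max (-R) (min R (F x)))
            (hν.integrable_sq.div_const R) (ae_of_all _ fun x => abs_sub_clamp_le hR)
      _ ≤ C / R := by rw [integral_div]; gcongr
  rw [Metric.tendsto_atTop]
  intro ε hε
  obtain ⟨R, hR, hCR⟩ : ∃ R : ℝ, 0 < R ∧ C / R < ε / 3 := by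
    refine ⟨3 * (C + 1) / ε, by positivity, ?_⟩
    rw [div_div_eq_mul_div, div_lt_div_iff₀ (by positivity) (by positivity)]
    nlinarith
  let G : BoundedContinuousFunction X ℝ := BoundedContinuousFunction.ofNormedAddCommGroup
    (fun x => max (-R) (min R (F x))) (continuous_const.max (continuous_const.min hF)) R
    (fun x => by
      rw [Real.norm_eq_abs, abs_le]
      exact ⟨le_max_left _ _, max_le (by linarith) (min_le_left _ _)⟩)
  have hG := (ProbabilityMeasure.tendsto_iff_forall_integral_tendsto.1 hμ) G
  obtain ⟨N, hN⟩ := eventually_atTop.1 (hC.and (Metric.tendsto_nhds.1 hG (ε / 3) (by positivity)))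
  refine ⟨N, fun n hn => ?_⟩
  obtain ⟨h1, h2⟩ := hN n hn
  have h3 := key (μ n) R hR (hL n) h1
  have h4 := key μ₀ R hR hL₀ hC₀
  rw [Real.dist_eq] at h2 ⊢
  change |∫ x, max (-R) (min R (F x)) ∂(μ n : Measure X) -
    ∫ x, max (-R) (min R (F x)) ∂(μ₀ : Measure X)| < ε / 3 at h2
  rw [abs_le] at h3 h4
  rw [abs_lt] at h2 ⊢
  constructor <;> linarith [h2.1, h2.2, h3.1, h3.2, h4.1, h4.2]

section Gaussian

variable {ι : Type*} [Fintype ι] [DecidableEq ι]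

lemma integral_exp_mul_eval {S : Matrix ι ι ℝ} (hS : S.PosSemidef) (t : ℝ) (p : ι) :
    Integrable (fun u : EuclideanSpace ℝ ι => Real.exp (t * u p)) (multivariateGaussian 0 S) ∧
    ∫ u, Real.exp (t * u p) ∂(multivariateGaussian 0 S) = Real.exp (S p p * t ^ 2 / 2) := by
  have hmp := measurePreserving_eval_multivariateGaussian (μ := 0) hS (i := p)
  refine ⟨hmp.integrable_comp_of_integrable
    (integrable_exp_mul_gaussianReal (μ := 0) (v := (S p p).toNNReal) t), ?_⟩
  have h := mgf_gaussianReal hmp.map_eq t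
  rw [mgf] at h
  rw [h, Real.coe_toNNReal _ hS.diag_nonneg]
  simp

variable {φ : ℝ → ℝ} {A B : ℝ}

lemma pow_four_le_exp (hb : ∀ u, |φ u| ≤ A * Real.exp (B * |u|)) (x : ℝ) :
    φ x ^ 4 ≤ A ^ 4 * (Real.exp (4 * B * x) + Real.exp (-(4 * B) * x)) := by
  have h1 : φ x ^ 4 ≤ (A * Real.exp (B * |x|)) ^ 4 := by
    rw [← (show Even 4 by decide).pow_abs]
    exact pow_le_pow_left₀ (abs_nonneg _) (hb x) 4
  refine h1.trans ?_
  rw [mul_pow, ← Real.exp_nat_mul]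
  gcongr
  rcases abs_cases x with ⟨h, -⟩ | ⟨h, -⟩ <;> rw [h]
  · refine le_add_of_le_of_nonneg (le_of_eq ?_) (Real.exp_nonneg _)
    congr 1; push_cast; ring
  · refine le_add_of_nonneg_of_le (Real.exp_nonneg _) (le_of_eq ?_)
    congr 1; push_cast; ring

lemma integral_pow_four_le (hc : Continuous φ)
    (hb : ∀ u, |φ u| ≤ A * Real.exp (B * |u|)) {S : Matrix ι ι ℝ} (hS : S.PosSemidef) (p : ι) :
    Integrable (fun u : EuclideanSpace ℝ ι => φ (u p) ^ 4) (multivariateGaussian 0 S) ∧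
    ∫ u, φ (u p) ^ 4 ∂(multivariateGaussian 0 S) ≤ 2 * A ^ 4 * Real.exp (8 * B ^ 2 * S p p) := by
  obtain ⟨i1, e1⟩ := integral_exp_mul_eval hS (4 * B) p
  obtain ⟨i2, e2⟩ := integral_exp_mul_eval hS (-(4 * B)) p
  have hi := (i1.add i2).const_mul (A ^ 4)
  have hi' : Integrable (fun u : EuclideanSpace ℝ ι => φ (u p) ^ 4)
      (multivariateGaussian 0 S) := by
    refine hi.mono' (by fun_prop) (ae_of_all _ fun u => ?_)
    rw [Real.norm_eq_abs, abs_of_nonneg (by positivity)]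
    exact pow_four_le_exp hb (u p)
  refine ⟨hi', (integral_mono hi' hi fun u => pow_four_le_exp hb (u p)).trans_eq ?_⟩
  simp only [Pi.add_apply]
  rw [integral_const_mul, integral_add i1 i2, e1, e2]
  ring_nf

/-- All pairs of activations have a second moment which is bounded locally uniformly in the
covariance. -/
lemma memLp_mul_eval (hc : Continuous φ)
    (hb : ∀ u, |φ u| ≤ A * Real.exp (B * |u|)) {S : Matrix ι ι ℝ} (hS : S.PosSemidef) (p q : ι) :
    MemLp (fun u : EuclideanSpace ℝ ι => φ (u p) * φ (u q)) 2 (multivariateGaussian 0 S) ∧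
    ∫ u, (φ (u p) * φ (u q)) ^ 2 ∂(multivariateGaussian 0 S) ≤
      A ^ 4 * (Real.exp (8 * B ^ 2 * S p p) + Real.exp (8 * B ^ 2 * S q q)) := by
  obtain ⟨i1, e1⟩ := integral_pow_four_le hc hb hS p
  obtain ⟨i2, e2⟩ := integral_pow_four_le hc hb hS q
  have hle : ∀ u : EuclideanSpace ℝ ι,
      (φ (u p) * φ (u q)) ^ 2 ≤ (φ (u p) ^ 4 + φ (u q) ^ 4) / 2 := fun u => by
    nlinarith [sq_nonneg (φ (u p) ^ 2 - φ (u q) ^ 2)]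
  have hi := (i1.add i2).div_const 2
  have hi' : Integrable (fun u : EuclideanSpace ℝ ι => (φ (u p) * φ (u q)) ^ 2)
      (multivariateGaussian 0 S) := by
    refine hi.mono' (by fun_prop) (ae_of_all _ fun u => ?_)
    rw [Real.norm_eq_abs, abs_of_nonneg (by positivity)]
    exact hle u
  refine ⟨(memLp_two_iff_integrable_sq (by fun_prop)).2 hi', ?_⟩
  refine (integral_mono hi' hi hle).trans ?_
  simp only [Pi.add_apply]
  rw [integral_div, integral_add i1 i2]
  linarith

lemma integrable_mul_eval (hc : Continuous φ)
    (hb : ∀ u, |φ u| ≤ A * Real.exp (B * |u|)) {S : Matrix ι ι ℝ} (hS : S.PosSemidef) (p q : ι) :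
    Integrable (fun u : EuclideanSpace ℝ ι => φ (u p) * φ (u q)) (multivariateGaussian 0 S) :=
  (memLp_mul_eval hc hb hS p q).1.integrable (by norm_num)

lemma exists_integral_sq_mul_eval_le (hc : Continuous φ)
    (hb : ∀ u, |φ u| ≤ A * Real.exp (B * |u|)) (S₀ : Matrix ι ι ℝ) (p q : ι) :
    ∃ C : ℝ, ∀ᶠ S in 𝓝[{S | S.PosSemidef}] S₀,
      ∫ u, (φ (u p) * φ (u q)) ^ 2 ∂(multivariateGaussian 0 S) ≤ C := by
  set g : Matrix ι ι ℝ → ℝ := fun S =>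
    A ^ 4 * (Real.exp (8 * B ^ 2 * S p p) + Real.exp (8 * B ^ 2 * S q q))
  have hgc : Continuous g := by
    have h1 : ∀ r : ι, Continuous fun S : Matrix ι ι ℝ => S r r := fun r =>
      continuous_id.matrix_elem r r
    have := h1 p
    have := h1 q
    fun_prop
  have hev : ∀ᶠ S in 𝓝[{S | S.PosSemidef}] S₀, g S < g S₀ + 1 :=
    hgc.continuousWithinAt.tendsto.eventually (gt_mem_nhds (by linarith))
  refine ⟨g S₀ + 1, ?_⟩
  filter_upwards [hev, self_mem_nhdsWithin] with S h1 hS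
  exact (memLp_mul_eval hc hb hS p q).2.trans h1.le

lemma tendsto_multivariateGaussian {S : ℕ → Matrix ι ι ℝ} {S₀ : Matrix ι ι ℝ}
    (hS : ∀ n, (S n).PosSemidef) (hS₀ : S₀.PosSemidef) (h : Tendsto S atTop (𝓝 S₀)) :
    Tendsto (β := ProbabilityMeasure (EuclideanSpace ℝ ι))
      (fun n => ⟨multivariateGaussian 0 (S n), inferInstance⟩) atTop
      (𝓝 ⟨multivariateGaussian 0 S₀, inferInstance⟩) := by
  refine ProbabilityMeasure.tendsto_of_tendsto_charFun fun t => ?_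
  simp only [ProbabilityMeasure.coe_mk, charFun_multivariateGaussian (hS _),
    charFun_multivariateGaussian hS₀]
  have hcont : Continuous fun K : Matrix ι ι ℝ => t.ofLp ⬝ᵥ K.mulVec t.ofLp := by fun_prop
  have h2 := (hcont.tendsto S₀).comp h
  have h3 : Continuous fun r : ℝ =>
      Complex.exp ((inner ℝ t (0 : EuclideanSpace ℝ ι) : ℝ) * Complex.I - (r : ℂ) / 2) := by
    fun_prop
  exact (h3.tendsto _).comp h2

/-- The Gaussian expectation `𝔼 [φ(u_p) φ(u_q)]`, `u ∼ N(0, S)`, depends continuously on the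
positive semidefinite covariance `S`. -/
lemma tendsto_integral_mul_eval (hc : Continuous φ)
    (hb : ∀ u, |φ u| ≤ A * Real.exp (B * |u|)) {S₀ : Matrix ι ι ℝ} (hS₀ : S₀.PosSemidef)
    (p q : ι) :
    Tendsto (fun S => ∫ u, φ (u p) * φ (u q) ∂(multivariateGaussian 0 S))
      (𝓝[{S | S.PosSemidef}] S₀)
      (𝓝 (∫ u, φ (u p) * φ (u q) ∂(multivariateGaussian 0 S₀))) := by
  have : FirstCountableTopology (Matrix ι ι ℝ) :=
    inferInstanceAs (FirstCountableTopology (ι → ι → ℝ))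
  refine tendsto_of_seq_tendsto fun s hs => ?_
  rw [tendsto_nhdsWithin_iff] at hs
  obtain ⟨hs, hpsd⟩ := hs
  obtain ⟨N, hN⟩ := eventually_atTop.1 hpsd
  rw [← tendsto_add_atTop_iff_nat N] at hs ⊢
  have hpsd' : ∀ n, (s (n + N)).PosSemidef := fun n => hN _ (Nat.le_add_left _ _)
  obtain ⟨C, hC⟩ := exists_integral_sq_mul_eval_le hc hb S₀ p q
  refine tendsto_integral_of_sq_bounded (C := C)
    (tendsto_multivariateGaussian hpsd' hS₀ hs) (F := fun u => φ (u p) * φ (u q)) (by fun_prop)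
    (fun n => (memLp_mul_eval hc hb (hpsd' n) p q).1)
    (memLp_mul_eval hc hb hS₀ p q).1 ?_ (hC.self_of_nhdsWithin hS₀)
  exact (tendsto_nhdsWithin_iff.2 ⟨hs, Eventually.of_forall hpsd'⟩).eventually hC

/-- A weak law of large numbers, uniform in the covariance `S` of the sampled vectors: for `M`
independent samples of `N(0, S)` with `S` close to `S₀`, the empirical mean of `φ(u_p) φ(u_q)` is
`ε`-close to its expectation under `N(0, S₀)`, up to probability `C / M`. -/
lemma exists_deviation_le (hc : Continuous φ)
    (hb : ∀ u, |φ u| ≤ A * Real.exp (B * |u|)) {S₀ : Matrix ι ι ℝ} (hS₀ : S₀.PosSemidef)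
    (p q : ι) {ε : ℝ} (hε : 0 < ε) :
    ∃ C : ℝ, ∀ᶠ S in 𝓝[{S | S.PosSemidef}] S₀, ∀ M : ℕ, 0 < M →
      Measure.pi (fun _ : Fin M => multivariateGaussian 0 S)
        {u | ε ≤ |1 / (M : ℝ) * ∑ i, φ (u i p) * φ (u i q) -
          ∫ u, φ (u p) * φ (u q) ∂(multivariateGaussian 0 S₀)|} ≤ ENNReal.ofReal (C / M) := by
  obtain ⟨C, hC⟩ := exists_integral_sq_mul_eval_le hc hb S₀ p q
  have hmean := Metric.tendsto_nhds.1 (tendsto_integral_mul_eval hc hb hS₀ p q) (ε / 2)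
    (by positivity)
  refine ⟨C / (ε / 2) ^ 2, ?_⟩
  filter_upwards [hC, hmean, self_mem_nhdsWithin] with S h1 h2 hS M hM
  have hM' : (0 : ℝ) < M := by exact_mod_cast hM
  set f : EuclideanSpace ℝ ι → ℝ := fun u => φ (u p) * φ (u q) with hf
  set γ := multivariateGaussian (0 : EuclideanSpace ℝ ι) S with hγ
  set c₀ := ∫ u, φ (u p) * φ (u q) ∂(multivariateGaussian 0 S₀)
  have hL := (memLp_mul_eval hc hb hS p q).1
  have hLi : ∀ i : Fin M, MemLp (fun u : Fin M → EuclideanSpace ℝ ι => f (u i)) 2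
      (Measure.pi fun _ : Fin M => γ) := fun i =>
    hL.comp_measurePreserving (measurePreserving_eval _ i)
  set X : (Fin M → EuclideanSpace ℝ ι) → ℝ := fun u => 1 / (M : ℝ) * ∑ i, f (u i) with hX
  have hXL : MemLp X 2 (Measure.pi fun _ : Fin M => γ) :=
    (memLp_finsetSum _ fun i _ => hLi i).const_mul _
  have hXmean : ∫ u, X u ∂(Measure.pi fun _ : Fin M => γ) = ∫ u, f u ∂γ := by
    rw [hX, integral_const_mul, integral_finsetSum _ fun i _ => (hLi i).integrable (by norm_num)]
    have : ∀ i : Fin M, ∫ u, f (u i) ∂(Measure.pi fun _ : Fin M => γ) = ∫ u, f u ∂γ := fun i => by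
      rw [integral_comp_eval (μ := fun _ : Fin M => γ) (i := i) hL.aestronglyMeasurable]
    simp only [this, Finset.sum_const, Finset.card_univ, Fintype.card_fin, nsmul_eq_mul]
    field_simp
  have hXvar : Var[X; Measure.pi fun _ : Fin M => γ] ≤ C / M := by
    have e1 : X = fun u =>
        1 / (M : ℝ) * (∑ i, fun u : Fin M → EuclideanSpace ℝ ι => f (u i)) u := by
      ext u; simp [hX]
    rw [e1, variance_const_mul, variance_sum_pi (X := fun _ => f) fun _ => hL]
    have hv : Var[f; γ] ≤ C :=
      (variance_le_expectation_sq hL.aestronglyMeasurable).trans h1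
    simp only [Finset.sum_const, Finset.card_univ, Fintype.card_fin, nsmul_eq_mul]
    calc (1 / (M : ℝ)) ^ 2 * (M * Var[f; γ]) = Var[f; γ] / M := by field_simp
      _ ≤ _ := by gcongr
  calc _ ≤ (Measure.pi fun _ : Fin M => γ)
        {u | ε / 2 ≤ |X u - ∫ u, X u ∂(Measure.pi fun _ : Fin M => γ)|} := by
        refine measure_mono fun u hu => ?_
        simp only [Set.mem_ofPred_eq] at hu ⊢
        rw [hXmean]
        rw [Real.dist_eq] at h2
        have := abs_sub_le (X u) (∫ u, f u ∂γ) c₀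
        linarith
    _ ≤ ENNReal.ofReal (Var[X; Measure.pi fun _ : Fin M => γ] / (ε / 2) ^ 2) :=
        meas_ge_le_variance_div_sq hXL (by positivity)
    _ ≤ _ := by
        refine ENNReal.ofReal_le_ofReal ?_
        rw [div_right_comm]
        gcongr

end Gaussian

/-! ### Positive semidefiniteness of the kernels -/

section Kernels

variable {𝒳 : Type*} {d : ℕ}

/-- The empirical uncentered covariance of the `N` channels of a layer `y`. -/
noncomputable def empiricalCov {ι : Type*} {N : ℕ} (y : Fin N → ι → ℝ) : Matrix ι ι ℝ :=
  Matrix.of fun p q => (1 / (N : ℝ)) * ∑ j, y j p * y j q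

lemma posSemidef_empiricalCov {ι : Type*} [Fintype ι] {N : ℕ} (y : Fin N → ι → ℝ) :
    (empiricalCov y).PosSemidef := by
  have h : empiricalCov y = (1 / (N : ℝ)) • ∑ j, Matrix.vecMulVec (y j) (star (y j)) := by
    ext p q
    simp [empiricalCov, Matrix.sum_apply, Matrix.vecMulVec_apply]
  rw [h]
  exact (Matrix.posSemidef_sum _ fun j _ => Matrix.posSemidef_vecMulVec_self_star _).smul
    (by positivity)

variable (k : ℕ) (v : ℤ → ℝ≥0) (σw σb : ℝ≥0)

lemma posSemidef_affineMap [Fintype 𝒳] [NeZero d] {K : Matrix (𝒳 × ZMod d) (𝒳 × ZMod d) ℝ}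
    (hK : K.PosSemidef) :
    (affineMap k v σw σb K).PosSemidef := by
  set one : 𝒳 × ZMod d → ℝ := fun _ => 1
  have h : affineMap k v σw σb K = ((σb : ℝ) ^ 2) • Matrix.vecMulVec one (star one) +
      ((σw : ℝ) ^ 2) • ∑ β ∈ offsets k, (v β : ℝ) •
        K.submatrix (fun p => (p.1, p.2 + (β : ZMod d))) (fun p => (p.1, p.2 + (β : ZMod d))) := by
    ext p q
    simp [affineMap, Matrix.sum_apply, Matrix.vecMulVec_apply, one]
  rw [h]
  refine ((Matrix.posSemidef_vecMulVec_self_star _).smul (by positivity)).add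
    ((Matrix.posSemidef_sum _ fun β _ => ?_).smul (by positivity))
  exact (hK.submatrix _).smul (by positivity)

lemma continuous_affineMap : Continuous (affineMap (𝒳 := 𝒳) (d := d) k v σw σb) := by
  refine continuous_matrix fun p q => ?_
  simp only [affineMap, Matrix.of_apply]
  have h : ∀ p q : 𝒳 × ZMod d, Continuous fun K : Matrix (𝒳 × ZMod d) (𝒳 × ZMod d) ℝ => K p q :=
    fun p q => continuous_id.matrix_elem p q
  exact continuous_const.add (continuous_const.mul
    (continuous_finsetSum _ fun β _ => continuous_const.mul (h _ _)))

variable [Fintype 𝒳] [NeZero d] [DecidableEq 𝒳] {φ : ℝ → ℝ} {A B : ℝ}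

lemma posSemidef_covMap (hc : Continuous φ) (hb : ∀ u, |φ u| ≤ A * Real.exp (B * |u|))
    {S : Matrix (𝒳 × ZMod d) (𝒳 × ZMod d) ℝ} (hS : S.PosSemidef) :
    (covMap φ S).PosSemidef := by
  refine Matrix.PosSemidef.of_dotProduct_mulVec_nonneg ?_ fun c => ?_
  · ext p q
    simp [covMap, mul_comm]
  · have hi := fun p q => integrable_mul_eval hc hb hS p q
    have h : star c ⬝ᵥ (covMap φ S).mulVec c =
        ∫ u, (∑ p, c p * φ (u p)) ^ 2 ∂(multivariateGaussian 0 S) := by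
      have e : ∀ u : EuclideanSpace ℝ (𝒳 × ZMod d), (∑ p, c p * φ (u p)) ^ 2 =
          ∑ p, ∑ q, c p * c q * (φ (u p) * φ (u q)) := fun u => by
        rw [sq, Finset.sum_mul_sum]
        exact Finset.sum_congr rfl fun p _ => Finset.sum_congr rfl fun q _ => by ring
      simp only [e]
      rw [integral_finsetSum _ fun p _ => integrable_finsetSum _ fun q _ => (hi p q).const_mul _]
      simp only [dotProduct, Matrix.mulVec, star_trivial, covMap, Matrix.of_apply]
      refine Finset.sum_congr rfl fun p _ => ?_
      rw [integral_finsetSum _ fun q _ => (hi p q).const_mul _, Finset.mul_sum]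
      refine Finset.sum_congr rfl fun q _ => ?_
      rw [integral_const_mul]
      ring
    rw [h]
    exact integral_nonneg fun u => sq_nonneg _

lemma limitKernel_succ (n₀ : ℕ) (x : 𝒳 → Fin n₀ → ZMod d → ℝ) (l : ℕ) :
    limitKernel φ k v σw σb x (l + 1) =
      covMap φ (affineMap k v σw σb (limitKernel φ k v σw σb x l)) := by
  simp only [limitKernel, Function.iterate_succ_apply', Function.comp_apply]

lemma posSemidef_limitKernel (hc : Continuous φ) (hb : ∀ u, |φ u| ≤ A * Real.exp (B * |u|))
    {n₀ : ℕ} (x : 𝒳 → Fin n₀ → ZMod d → ℝ) (l : ℕ) :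
    (limitKernel φ k v σw σb x l).PosSemidef := by
  induction l with
  | zero => exact posSemidef_empiricalCov _
  | succ l ih =>
    rw [limitKernel_succ]
    exact posSemidef_covMap hc hb (posSemidef_affineMap k v σw σb ih)

end Kernels

/-! ### The law of a layer with frozen inputs -/

section Layer

variable {𝒳 : Type*} {d : ℕ}

/-- Indices of the weights and biases of a single layer with `N` input and `M` output channels. -/
abbrev LayerIndex (k N M : ℕ) : Type :=
  (Fin M × Fin N × {β : ℤ // β ∈ offsets k}) ⊕ Fin M

/-- The variances of the parameters of a single layer. -/
noncomputable def layerVar (k N M : ℕ) (v : ℤ → ℝ≥0) (σw σb : ℝ≥0) : LayerIndex k N M → ℝ≥0 :=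
  Sum.elim (fun τ => v τ.2.2 * (σw ^ 2 / (N : ℝ≥0))) (fun _ => σb ^ 2)

/-- The law of the parameters of a single layer. -/
noncomputable def layerMeasure (k N M : ℕ) (v : ℤ → ℝ≥0) (σw σb : ℝ≥0) :
    Measure (LayerIndex k N M → ℝ) :=
  Measure.pi fun τ => gaussianReal 0 (layerVar k N M v σw σb τ)

instance (k N M : ℕ) (v : ℤ → ℝ≥0) (σw σb : ℝ≥0) :
    IsProbabilityMeasure (layerMeasure k N M v σw σb) := by
  unfold layerMeasure; infer_instance

/-- The output of a convolutional layer with input `y` and parameters `θ`, one vector indexed by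
all inputs and pixels for each output channel. -/
noncomputable def layerOut {k N M : ℕ} (y : Fin N → 𝒳 × ZMod d → ℝ) (θ : LayerIndex k N M → ℝ) :
    Fin M → EuclideanSpace ℝ (𝒳 × ZMod d) :=
  fun i => WithLp.toLp 2 fun p =>
    (∑ j, ∑ β : {β : ℤ // β ∈ offsets k},
      θ (Sum.inl (i, j, β)) * y j (p.1, p.2 + ((β : ℤ) : ZMod d))) + θ (Sum.inr i)

lemma measurable_layerOut {k N M : ℕ} :
    Measurable fun a : (Fin N → 𝒳 × ZMod d → ℝ) × (LayerIndex k N M → ℝ) =>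
      layerOut a.1 a.2 := by
  unfold layerOut
  fun_prop

section FrozenInputs

variable [Fintype 𝒳] [NeZero d]

/-- With `t = (t_{i,p})` the test vector, `∑_{i,p} t_{i,p} z_{i,p}` is linear in the layer
parameters; these are its coefficients. -/
noncomputable def layerCoeff {k N M : ℕ} (y : Fin N → 𝒳 × ZMod d → ℝ)
    (t : Fin M → EuclideanSpace ℝ (𝒳 × ZMod d)) : LayerIndex k N M → ℝ :=
  Sum.elim (fun τ => ∑ p, t τ.1 p * y τ.2.1 (p.1, p.2 + ((τ.2.2 : ℤ) : ZMod d)))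
    (fun i => ∑ p, t i p)

lemma sum_inner_layerOut {k N M : ℕ} (y : Fin N → 𝒳 × ZMod d → ℝ) (θ : LayerIndex k N M → ℝ)
    (t : Fin M → EuclideanSpace ℝ (𝒳 × ZMod d)) :
    ∑ i, inner ℝ (layerOut y θ i) (t i) = ∑ τ, θ τ * layerCoeff y t τ := by
  rw [Fintype.sum_sum_type, Fintype.sum_prod_type, ← Finset.sum_add_distrib]
  refine Finset.sum_congr rfl fun i _ => ?_
  rw [Fintype.sum_prod_type]
  simp only [layerOut, layerCoeff, Sum.elim_inl, Sum.elim_inr, PiLp.inner_apply,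
    RCLike.inner_apply, conj_trivial, Finset.mul_sum, mul_add, Finset.sum_add_distrib]
  congr 1
  · rw [Finset.sum_comm]
    refine Finset.sum_congr rfl fun j _ => ?_
    rw [Finset.sum_comm]
    exact Finset.sum_congr rfl fun β _ => Finset.sum_congr rfl fun p _ => by ring
  · exact Finset.sum_congr rfl fun p _ => by ring

/-- The variance of `∑_{i,p} t_{i,p} z_{i,p}` for frozen inputs is the quadratic form of the
affine map applied to the empirical covariance of the inputs. -/
lemma sum_layerVar_mul_layerCoeff_sq {k N M : ℕ} (v : ℤ → ℝ≥0) (σw σb : ℝ≥0)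
    (y : Fin N → 𝒳 × ZMod d → ℝ) (t : Fin M → EuclideanSpace ℝ (𝒳 × ZMod d)) :
    ∑ τ, (layerVar k N M v σw σb τ : ℝ) * layerCoeff y t τ ^ 2 =
      ∑ i, (t i).ofLp ⬝ᵥ (affineMap k v σw σb (empiricalCov y)).mulVec (t i).ofLp := by
  rw [Fintype.sum_sum_type, Fintype.sum_prod_type, ← Finset.sum_add_distrib]
  refine Finset.sum_congr rfl fun i _ => ?_
  rw [Fintype.sum_prod_type]
  have e1 : ∀ (c : 𝒳 × ZMod d → ℝ), (∑ p, c p) ^ 2 = ∑ p, ∑ q, c p * c q := fun c => by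
    rw [sq, Finset.sum_mul_sum]
  simp only [layerVar, layerCoeff, Sum.elim_inl, Sum.elim_inr, dotProduct, Matrix.mulVec,
    affineMap, empiricalCov, Matrix.of_apply, e1, Finset.mul_sum, Finset.sum_mul, add_mul, mul_add,
    Finset.sum_add_distrib, NNReal.coe_mul, NNReal.coe_div, NNReal.coe_pow, NNReal.coe_natCast]
  rw [add_comm]
  congr 1
  · exact Finset.sum_congr rfl fun p _ => Finset.sum_congr rfl fun q _ => by ring
  · -- bring both sides to the order of summation `p, q, β, j`
    have e2 : ∀ f : Fin N → {β : ℤ // β ∈ offsets k} → 𝒳 × ZMod d → 𝒳 × ZMod d → ℝ,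
        ∑ j, ∑ β, ∑ p, ∑ q, f j β p q = ∑ p, ∑ q, ∑ β, ∑ j, f j β p q := fun f => by
      have h1 : ∀ p q, ∑ β, ∑ j, f j β p q = ∑ j, ∑ β, f j β p q := fun p q => Finset.sum_comm
      simp only [h1]
      simp only [Finset.sum_comm (s := (Finset.univ : Finset (𝒳 × ZMod d)))
        (t := (Finset.univ : Finset (Fin N)))]
      refine Finset.sum_congr rfl fun j _ => ?_
      simp only [Finset.sum_comm (s := (Finset.univ : Finset (𝒳 × ZMod d)))
        (t := (Finset.univ : Finset {β : ℤ // β ∈ offsets k}))]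
    rw [e2]
    refine Finset.sum_congr rfl fun p _ => Finset.sum_congr rfl fun q _ => ?_
    rw [← Finset.sum_coe_sort (offsets k)]
    refine Finset.sum_congr rfl fun β _ => Finset.sum_congr rfl fun j _ => ?_
    ring

/-- For frozen inputs, the channels of the output of a layer are independent Gaussian vectors with
covariance `𝒜 K`, where `K` is the empirical covariance of the inputs. -/
lemma map_layerOut [DecidableEq 𝒳] (k N M : ℕ) (v : ℤ → ℝ≥0) (σw σb : ℝ≥0)
    (y : Fin N → 𝒳 × ZMod d → ℝ) :
    (layerMeasure k N M v σw σb).map (layerOut y) =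
      Measure.pi fun _ : Fin M =>
        multivariateGaussian 0 (affineMap k v σw σb (empiricalCov y)) := by
  have hm : Measurable (layerOut (M := M) (k := k) y) := by
    unfold layerOut
    fun_prop
  have : IsProbabilityMeasure ((layerMeasure k N M v σw σb).map (layerOut y)) :=
    Measure.isProbabilityMeasure_map hm.aemeasurable
  refine charFun_eq_pi_iff.1 fun t => ?_
  have hpsd := posSemidef_affineMap k v σw σb (posSemidef_empiricalCov y)
  simp only [charFun_multivariateGaussian hpsd, inner_zero_right, Complex.ofReal_zero, zero_mul,
    zero_sub]
  have h1 : charFun (((layerMeasure k N M v σw σb).map (layerOut y)).map (WithLp.toLp 2)) t =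
      charFun ((layerMeasure k N M v σw σb).map (WithLp.toLp 2))
        (WithLp.toLp 2 (layerCoeff y t)) := by
    rw [charFun_apply, charFun_apply, integral_map (by fun_prop) (by fun_prop),
      integral_map (by fun_prop) (by fun_prop), integral_map (by fun_prop) (by fun_prop)]
    congr 1
    ext θ
    congr 3
    rw [PiLp.inner_apply, PiLp.inner_apply]
    refine (sum_inner_layerOut y θ t).trans ?_
    exact Finset.sum_congr rfl fun τ _ => by
      simp [mul_comm]
  rw [h1, layerMeasure, charFun_pi]
  simp only [charFun_gaussianReal, ← Complex.exp_sum]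
  congr 1
  rw [Finset.sum_neg_distrib, ← Finset.sum_div, ← Complex.ofReal_sum,
    ← sum_layerVar_mul_layerCoeff_sq, Complex.ofReal_sum, Finset.sum_div, ← Finset.sum_neg_distrib]
  refine Finset.sum_congr rfl fun τ _ => ?_
  push_cast
  ring

end FrozenInputs

/-- The vector of all coordinates of a finite family of vectors. -/
def flatten {M : ℕ} {ι : Type*} (u : Fin M → EuclideanSpace ℝ ι) :
    EuclideanSpace ℝ (ι × Fin M) :=
  WithLp.toLp 2 fun p => u p.2 p.1

lemma measurable_flatten {M : ℕ} {ι : Type*} [Fintype ι] :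
    Measurable (flatten : (Fin M → EuclideanSpace ℝ ι) → _) := by
  unfold flatten
  fun_prop

/-- A family of `M` independent vectors with law `N(0, S)` has law `N(0, S ⊗ I_M)`. -/
lemma map_flatten_pi {ι : Type*} [Fintype ι] [DecidableEq ι] (M : ℕ) {S : Matrix ι ι ℝ}
    (hS : S.PosSemidef) :
    (Measure.pi fun _ : Fin M => multivariateGaussian 0 S).map flatten =
      multivariateGaussian 0 (S ⊗ₖ (1 : Matrix (Fin M) (Fin M) ℝ)) := by
  have hS' : (S ⊗ₖ (1 : Matrix (Fin M) (Fin M) ℝ)).PosSemidef :=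
    hS.kronecker Matrix.PosSemidef.one
  have : IsProbabilityMeasure
      ((Measure.pi fun _ : Fin M => multivariateGaussian 0 S).map flatten) :=
    Measure.isProbabilityMeasure_map measurable_flatten.aemeasurable
  refine Measure.ext_of_charFun (funext fun s => ?_)
  rw [charFun_multivariateGaussian hS']
  set t : PiLp 2 fun _ : Fin M => EuclideanSpace ℝ ι :=
    WithLp.toLp 2 fun i => WithLp.toLp 2 fun p => s (p, i) with ht
  have h1 : charFun ((Measure.pi fun _ : Fin M => multivariateGaussian 0 S).map flatten) s =
      charFun ((Measure.pi fun _ : Fin M => multivariateGaussian 0 S).map (WithLp.toLp 2)) t := by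
    rw [charFun_apply, charFun_apply,
      integral_map measurable_flatten.aemeasurable (by fun_prop),
      integral_map (by fun_prop) (by fun_prop)]
    congr 1
    ext u
    congr 3
    simp only [PiLp.inner_apply, Fintype.sum_prod_type, flatten, ht]
    rw [Finset.sum_comm]
  rw [h1, charFun_pi]
  simp only [charFun_multivariateGaussian hS, inner_zero_right, Complex.ofReal_zero, zero_mul,
    zero_sub]
  rw [← Complex.exp_sum, Finset.sum_neg_distrib, ← Finset.sum_div, ← Complex.ofReal_sum]
  congr 4
  simp only [dotProduct, Matrix.mulVec, Fintype.sum_prod_type, Matrix.kroneckerMap_apply,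
    Matrix.one_apply, mul_ite, mul_one, mul_zero, ite_mul, zero_mul, Finset.sum_ite_eq,
    Finset.mem_univ, if_true, ht]
  rw [Finset.sum_comm]

end Layer

/-! ### Layers with random inputs -/

section RandomInput

variable {𝒳 : Type*} {d : ℕ} {k N M : ℕ} {v : ℤ → ℝ≥0}
  {σw σb : ℝ≥0} {Ω : Type*} [MeasurableSpace Ω] {P : Measure Ω} [IsProbabilityMeasure P]
  {Y : Ω → Fin N → 𝒳 × ZMod d → ℝ} {Θ : Ω → LayerIndex k N M → ℝ}

lemma map_prodMk_layer (hY : Measurable Y) (hΘ : HasLaw Θ (layerMeasure k N M v σw σb) P)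
    (hI : IndepFun Y Θ P) :
    P.map (fun ω => (Y ω, Θ ω)) = (P.map Y).prod (layerMeasure k N M v σw σb) := by
  rw [(indepFun_iff_map_prod_eq_prod_map_map hY.aemeasurable hΘ.aemeasurable).1 hI, hΘ.map_eq]

variable [Fintype 𝒳] [DecidableEq 𝒳] [NeZero d]

/-- Fubini: the probability of an event about the output of a layer is obtained by freezing the
inputs, which turns the output into independent Gaussian vectors. -/
lemma measure_layerOut_mem (hY : Measurable Y)
    (hΘ : HasLaw Θ (layerMeasure k N M v σw σb) P) (hI : IndepFun Y Θ P)
    {T : Set (Fin M → EuclideanSpace ℝ (𝒳 × ZMod d))} (hT : MeasurableSet T) :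
    P {ω | layerOut (Y ω) (Θ ω) ∈ T} = ∫⁻ ω, Measure.pi (fun _ : Fin M =>
      multivariateGaussian 0 (affineMap k v σw σb (empiricalCov (Y ω)))) T ∂P := by
  have hT' : MeasurableSet {a : (Fin N → 𝒳 × ZMod d → ℝ) × (LayerIndex k N M → ℝ) |
      layerOut a.1 a.2 ∈ T} := measurable_layerOut hT
  have h1 : P {ω | layerOut (Y ω) (Θ ω) ∈ T} = P.map (fun ω => (Y ω, Θ ω))
      {a | layerOut a.1 a.2 ∈ T} := by
    rw [Measure.map_apply_of_aemeasurable (hY.aemeasurable.prodMk hΘ.aemeasurable) hT']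
    rfl
  rw [h1, map_prodMk_layer hY hΘ hI, Measure.prod_apply hT',
    lintegral_map (measurable_measure_prodMk_left hT') hY]
  refine lintegral_congr fun ω => ?_
  rw [← map_layerOut, Measure.map_apply (by unfold layerOut; fun_prop) hT]
  rfl

/-- The characteristic function of the output of a layer is the mean of the Gaussian
characteristic functions for frozen inputs. -/
lemma charFun_map_flatten_layerOut (hY : Measurable Y)
    (hΘ : HasLaw Θ (layerMeasure k N M v σw σb) P) (hI : IndepFun Y Θ P)
    (s : EuclideanSpace ℝ ((𝒳 × ZMod d) × Fin M)) :
    charFun (P.map fun ω => flatten (layerOut (Y ω) (Θ ω))) s =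
      ∫ ω, charFun (multivariateGaussian 0 (affineMap k v σw σb (empiricalCov (Y ω)) ⊗ₖ
        (1 : Matrix (Fin M) (Fin M) ℝ))) s ∂P := by
  obtain ⟨f, hf⟩ : ∃ f : (Fin N → 𝒳 × ZMod d → ℝ) × (LayerIndex k N M → ℝ) → ℂ, f = fun a =>
    Complex.exp ((inner ℝ (flatten (layerOut a.1 a.2)) s : ℝ) * Complex.I) := ⟨_, rfl⟩
  have hfa : ∀ y θ, f (y, θ) =
      Complex.exp ((inner ℝ (flatten (layerOut y θ)) s : ℝ) * Complex.I) := fun y θ => by rw [hf]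
  have hfl : Measurable fun a : (Fin N → 𝒳 × ZMod d → ℝ) × (LayerIndex k N M → ℝ) =>
      flatten (layerOut a.1 a.2) := measurable_flatten.comp measurable_layerOut
  have hfm : Measurable f := by
    have h : Measurable fun u : EuclideanSpace ℝ ((𝒳 × ZMod d) × Fin M) =>
        Complex.exp ((inner ℝ u s : ℝ) * Complex.I) := by fun_prop
    rw [hf]
    exact h.comp hfl
  have hpair : AEMeasurable (fun ω => (Y ω, Θ ω)) P :=
    hY.aemeasurable.prodMk hΘ.aemeasurable
  have hPY : IsProbabilityMeasure (P.map Y) := Measure.isProbabilityMeasure_map hY.aemeasurable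
  have hfi : Integrable f ((P.map Y).prod (layerMeasure k N M v σw σb)) :=
    Integrable.of_bound (C := 1) hfm.aestronglyMeasurable
      (ae_of_all _ fun a => by rw [hf, Complex.norm_exp_ofReal_mul_I])
  have h1 : charFun (P.map fun ω => flatten (layerOut (Y ω) (Θ ω))) s =
      ∫ a, f a ∂(P.map fun ω => (Y ω, Θ ω)) := by
    have hcomp : AEMeasurable (fun ω => flatten (layerOut (Y ω) (Θ ω))) P := by
      have h := hfl.comp_aemeasurable hpair
      exact h
    rw [integral_map hpair hfm.aestronglyMeasurable, charFun_apply,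
      integral_map hcomp (by fun_prop)]
    exact integral_congr_ae (ae_of_all _ fun ω => (hfa (Y ω) (Θ ω)).symm)
  rw [h1, map_prodMk_layer hY hΘ hI, integral_prod _ hfi,
    integral_map hY.aemeasurable hfm.stronglyMeasurable.integral_prod_right'.aestronglyMeasurable]
  refine integral_congr_ae (ae_of_all _ fun ω => ?_)
  have hlm : Measurable (layerOut (k := k) (M := M) (Y ω)) := by unfold layerOut; fun_prop
  simp only [hfa]
  rw [← map_flatten_pi M (posSemidef_affineMap k v σw σb (posSemidef_empiricalCov (Y ω))),
    ← map_layerOut, Measure.map_map measurable_flatten hlm, charFun_apply,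
    integral_map (measurable_flatten.comp hlm).aemeasurable (by fun_prop)]
  simp only [Function.comp_apply]

end RandomInput

/-! ### The network as a composition of layers -/

section Network

variable {d : ℕ} {φ : ℝ → ℝ} {k : ℕ} {n : ℕ → ℕ}

lemma activation_congr {w w' : ℕ → ℕ → ℕ → ℤ → ℝ} {b b' : ℕ → ℕ → ℝ} (y₀ : ℕ → ZMod d → ℝ)
    (l : ℕ) (hw : ∀ l' < l, ∀ i < n (l' + 1), ∀ j < n l', ∀ β ∈ offsets k,
      w l' i j β = w' l' i j β) (hb : ∀ l' < l, ∀ i < n (l' + 1), b l' i = b' l' i) :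
    ∀ i < n l, ∀ α, activation φ k n w b y₀ l i α = activation φ k n w' b' y₀ l i α := by
  induction l with
  | zero => intros; rfl
  | succ l ih =>
    intro i hi α
    simp only [activation, conv]
    rw [hb l l.lt_succ_self i hi]
    congr 2
    refine Finset.sum_congr rfl fun j hj => Finset.sum_congr rfl fun β hβ => ?_
    rw [hw l l.lt_succ_self i hi j (Finset.mem_range.1 hj) β hβ,
      ih (fun l' h => hw l' (h.trans l.lt_succ_self)) (fun l' h => hb l' (h.trans l.lt_succ_self))
        j (Finset.mem_range.1 hj)]

lemma preactivation_congr {w w' : ℕ → ℕ → ℕ → ℤ → ℝ} {b b' : ℕ → ℕ → ℝ} (y₀ : ℕ → ZMod d → ℝ)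
    (l : ℕ) (hw : ∀ l' ≤ l, ∀ i < n (l' + 1), ∀ j < n l', ∀ β ∈ offsets k,
      w l' i j β = w' l' i j β) (hb : ∀ l' ≤ l, ∀ i < n (l' + 1), b l' i = b' l' i) :
    ∀ i < n (l + 1), ∀ α,
      preactivation φ k n w b y₀ l i α = preactivation φ k n w' b' y₀ l i α := by
  intro i hi α
  simp only [preactivation, conv]
  rw [hb l le_rfl i hi]
  congr 1
  refine Finset.sum_congr rfl fun j hj => Finset.sum_congr rfl fun β hβ => ?_
  rw [hw l le_rfl i hi j (Finset.mem_range.1 hj) β hβ,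
    activation_congr y₀ l (fun l' h => hw l' h.le) (fun l' h => hb l' h.le)
      j (Finset.mem_range.1 hj)]

lemma measurable_activation {Ω : Type*} [MeasurableSpace Ω] (hφ : Measurable φ)
    {w : ℕ → ℕ → ℕ → ℤ → Ω → ℝ} {b : ℕ → ℕ → Ω → ℝ} (y₀ : ℕ → ZMod d → ℝ) (l : ℕ)
    (hw : ∀ l' < l, ∀ i < n (l' + 1), ∀ j < n l', ∀ β ∈ offsets k, Measurable (w l' i j β))
    (hb : ∀ l' < l, ∀ i < n (l' + 1), Measurable (b l' i)) :
    ∀ i < n l, ∀ α, Measurable fun ω => activation φ k n (fun l i j β => w l i j β ω)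
      (fun l i => b l i ω) y₀ l i α := by
  induction l with
  | zero => intro i _ α; exact measurable_const
  | succ l ih =>
    intro i hi α
    refine hφ.comp (Measurable.add ?_ (hb l l.lt_succ_self i hi))
    refine Finset.measurable_sum _ fun j hj => Finset.measurable_sum _ fun β hβ => ?_
    refine (hw l l.lt_succ_self i hi j (Finset.mem_range.1 hj) β hβ).mul ?_
    exact ih (fun l' h => hw l' (h.trans l.lt_succ_self))
      (fun l' h => hb l' (h.trans l.lt_succ_self)) j (Finset.mem_range.1 hj) _

variable {𝒳 : Type*} {n₀ : ℕ}

/-- The activations of layer `l` on all inputs and pixels, one vector for each channel. -/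
noncomputable def layerActivation (φ : ℝ → ℝ) (k : ℕ) (n : ℕ → ℕ) (x : 𝒳 → Fin n₀ → ZMod d → ℝ)
    (w : ℕ → ℕ → ℕ → ℤ → ℝ) (b : ℕ → ℕ → ℝ) (l : ℕ) : Fin (n l) → 𝒳 × ZMod d → ℝ :=
  fun j p => activation φ k n w b (inputLayer (x p.1)) l j p.2

/-- The parameters of layer `l` as a vector. -/
def layerParam (k : ℕ) (n : ℕ → ℕ) (w : ℕ → ℕ → ℕ → ℤ → ℝ) (b : ℕ → ℕ → ℝ) (l : ℕ) :
    LayerIndex k (n l) (n (l + 1)) → ℝ :=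
  Sum.elim (fun τ => w l τ.1 τ.2.1 τ.2.2) (fun i => b l i)

lemma layerOut_layerActivation (x : 𝒳 → Fin n₀ → ZMod d → ℝ) (w : ℕ → ℕ → ℕ → ℤ → ℝ)
    (b : ℕ → ℕ → ℝ) (l : ℕ) (i : Fin (n (l + 1))) (p : 𝒳 × ZMod d) :
    layerOut (layerActivation φ k n x w b l) (layerParam k n w b l) i p =
      preactivation φ k n w b (inputLayer (x p.1)) l i p.2 := by
  simp only [layerOut, layerActivation, layerParam, preactivation, conv, Sum.elim_inl,
    Sum.elim_inr, Finset.sum_range]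
  congr 1
  refine Finset.sum_congr rfl fun j _ => ?_
  rw [← Finset.sum_coe_sort (offsets k)]

lemma layerActivation_succ (x : 𝒳 → Fin n₀ → ZMod d → ℝ) (w : ℕ → ℕ → ℕ → ℤ → ℝ)
    (b : ℕ → ℕ → ℝ) (l : ℕ) (i : Fin (n (l + 1))) (p : 𝒳 × ZMod d) :
    layerActivation φ k n x w b (l + 1) i p =
      φ (layerOut (layerActivation φ k n x w b l) (layerParam k n w b l) i p) := by
  rw [layerOut_layerActivation]
  rfl

lemma flatten_layerOut (x : 𝒳 → Fin n₀ → ZMod d → ℝ) (w : ℕ → ℕ → ℕ → ℤ → ℝ)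
    (b : ℕ → ℕ → ℝ) (L : ℕ) :
    flatten (layerOut (layerActivation φ k n x w b L) (layerParam k n w b L)) =
      topPreactivation φ k L (n (L + 1)) n x w b := by
  ext p
  exact layerOut_layerActivation x w b L p.2 p.1

lemma empiricalCov_layerActivation_zero (x : 𝒳 → Fin n₀ → ZMod d → ℝ)
    (w : ℕ → ℕ → ℕ → ℤ → ℝ) (b : ℕ → ℕ → ℝ) (hn : n 0 = n₀) :
    empiricalCov (layerActivation φ k n x w b 0) = inputCov x := by
  subst hn
  ext p q
  simp [empiricalCov, inputCov, layerActivation, activation, inputLayer]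

end Network

/-! ### Independence of the layers -/

section Prior

variable {Ω : Type*} {L k : ℕ} {n : ℕ → ℕ} {v : ℤ → ℝ≥0}
  {σw σb : ℝ≥0} {w : ℕ → ℕ → ℕ → ℤ → Ω → ℝ} {b : ℕ → ℕ → Ω → ℝ}

/-- The position of the parameters of layer `l` among all parameters of the network. -/
def layerEmbed {L k : ℕ} {n : ℕ → ℕ} {l : ℕ} (hl : l ≤ L) :
    LayerIndex k (n l) (n (l + 1)) → WeightIndex L k n ⊕ BiasIndex L n :=
  Sum.map (fun τ => ⟨⟨l, Nat.lt_succ_of_le hl⟩, τ⟩) (fun i => ⟨⟨l, Nat.lt_succ_of_le hl⟩, i⟩)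

lemma injective_layerEmbed {l : ℕ} (hl : l ≤ L) :
    Function.Injective (layerEmbed (k := k) (n := n) hl) := by
  unfold layerEmbed
  exact Function.Injective.sumMap (fun _ _ h => by simpa using h) (fun _ _ h => by simpa using h)

lemma paramFamily_layerEmbed {l : ℕ} (hl : l ≤ L) (τ : LayerIndex k (n l) (n (l + 1))) (ω : Ω) :
    paramFamily L k n w b (layerEmbed hl τ) ω =
      layerParam k n (fun l i j β => w l i j β ω) (fun l i => b l i ω) l τ := by
  rcases τ with τ | i <;> rfl

variable [MeasurableSpace Ω] {P : Measure Ω}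

/-- A parameter family which is only almost everywhere measurable has a measurable
modification with the same law. -/
lemma IsGaussianPrior.exists_measurable (h : IsGaussianPrior P L k n v σw σb w b) :
    ∃ (w' : ℕ → ℕ → ℕ → ℤ → Ω → ℝ) (b' : ℕ → ℕ → Ω → ℝ),
      (∀ l i j β, Measurable (w' l i j β)) ∧ (∀ l i, Measurable (b' l i)) ∧
      (∀ l ≤ L, ∀ i < n (l + 1), ∀ j < n l, ∀ β ∈ offsets k, w l i j β =ᵐ[P] w' l i j β) ∧
      (∀ l ≤ L, ∀ i < n (l + 1), b l i =ᵐ[P] b' l i) ∧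
      IsGaussianPrior P L k n v σw σb w' b' := by
  classical
  set w' : ℕ → ℕ → ℕ → ℤ → Ω → ℝ := fun l i j β =>
    if h : AEMeasurable (w l i j β) P then h.mk else 0
  set b' : ℕ → ℕ → Ω → ℝ := fun l i => if h : AEMeasurable (b l i) P then h.mk else 0
  have hw' : ∀ l ≤ L, ∀ i < n (l + 1), ∀ j < n l, ∀ β ∈ offsets k,
      w l i j β =ᵐ[P] w' l i j β := fun l hl i hi j hj β hβ => by
    have hm := (h.weight_law l hl i hi j hj β hβ).aemeasurable
    simp only [w', dif_pos hm]
    exact hm.ae_eq_mk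
  have hb' : ∀ l ≤ L, ∀ i < n (l + 1), b l i =ᵐ[P] b' l i := fun l hl i hi => by
    have hm := (h.bias_law l hl i hi).aemeasurable
    simp only [b', dif_pos hm]
    exact hm.ae_eq_mk
  refine ⟨w', b', fun l i j β => ?_, fun l i => ?_, hw', hb', ?_, ?_, ?_⟩
  · by_cases hm : AEMeasurable (w l i j β) P
    · simp only [w', dif_pos hm]; exact hm.measurable_mk
    · simp only [w', dif_neg hm]; exact measurable_const
  · by_cases hm : AEMeasurable (b l i) P
    · simp only [b', dif_pos hm]; exact hm.measurable_mk
    · simp only [b', dif_neg hm]; exact measurable_const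
  · exact fun l hl i hi j hj β hβ =>
      (h.weight_law l hl i hi j hj β hβ).congr (hw' l hl i hi j hj β hβ).symm
  · exact fun l hl i hi => (h.bias_law l hl i hi).congr (hb' l hl i hi).symm
  · refine h.indep.congr ?_
    rintro (⟨l, i, j, β⟩ | ⟨l, i⟩)
    · exact hw' l (Nat.lt_succ_iff.1 l.2) i i.2 j j.2 β β.2
    · exact hb' l (Nat.lt_succ_iff.1 l.2) i i.2

lemma IsGaussianPrior.hasLaw_layerParam (h : IsGaussianPrior P L k n v σw σb w b) {l : ℕ}
    (hl : l ≤ L) :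
    HasLaw (fun ω => layerParam k n (fun l i j β => w l i j β ω) (fun l i => b l i ω) l)
      (layerMeasure k (n l) (n (l + 1)) v σw σb) P := by
  have h1 := h.indep.precomp (injective_layerEmbed hl)
  have h2 : ∀ τ : LayerIndex k (n l) (n (l + 1)),
      HasLaw (paramFamily L k n w b (layerEmbed hl τ))
        (gaussianReal 0 (layerVar k (n l) (n (l + 1)) v σw σb τ)) P := by
    rintro (⟨i, j, β⟩ | i)
    · exact h.weight_law l hl i i.2 j j.2 β β.2
    · exact h.bias_law l hl i i.2
  have h3 := iIndepFun.hasLaw_pi h2 h1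
  simp only [paramFamily_layerEmbed hl] at h3
  exact h3

/-- The layer to which a parameter belongs. -/
def paramLayer {L k : ℕ} {n : ℕ → ℕ} : WeightIndex L k n ⊕ BiasIndex L n → ℕ :=
  Sum.elim (fun τ => τ.1) (fun τ => τ.1)

/-- The activations of a layer depend on the parameters of the previous layers only, hence are
independent of the parameters of the layer. -/
lemma IsGaussianPrior.indepFun_layerActivation (h : IsGaussianPrior P L k n v σw σb w b)
    (hw : ∀ l i j β, Measurable (w l i j β)) (hb : ∀ l i, Measurable (b l i))
    {𝒳 : Type*} {d n₀ : ℕ} (x : 𝒳 → Fin n₀ → ZMod d → ℝ) {φ : ℝ → ℝ} (hφ : Measurable φ)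
    {l : ℕ} (hl : l ≤ L) :
    IndepFun
      (fun ω => layerActivation φ k n x (fun l i j β => w l i j β ω) (fun l i => b l i ω) l)
      (fun ω => layerParam k n (fun l i j β => w l i j β ω) (fun l i => b l i ω) l) P := by
  set m : WeightIndex L k n ⊕ BiasIndex L n → MeasurableSpace Ω := fun τ =>
    MeasurableSpace.comap (paramFamily L k n w b τ) inferInstance with hm
  have hle : ∀ τ, m τ ≤ ‹MeasurableSpace Ω› := by
    rintro (⟨l, i, j, β⟩ | ⟨l, i⟩)
    · exact (hw l i j β).comap_le
    · exact (hb l i).comap_le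
  have hdisj : Disjoint {τ : WeightIndex L k n ⊕ BiasIndex L n | paramLayer τ < l}
      {τ | paramLayer τ = l} :=
    Set.disjoint_left.2 fun τ h1 h2 => (ne_of_lt h1) h2
  have hind := indep_iSup_of_disjoint hle h.indep hdisj
  have hmeas : ∀ (S : Set (WeightIndex L k n ⊕ BiasIndex L n)) (τ), τ ∈ S →
      Measurable[⨆ τ ∈ S, m τ] (paramFamily L k n w b τ) := fun S τ hτ =>
    (comap_measurable _).mono (le_iSup₂_of_le τ hτ le_rfl) le_rfl
  rw [IndepFun_iff_Indep]
  refine indep_of_indep_of_le_left (indep_of_indep_of_le_right hind ?_) ?_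
  · refine Measurable.comap_le (@measurable_pi_lambda _ _ _ (_) _ _ fun τ => ?_)
    have h2 := hmeas {τ | paramLayer τ = l} (layerEmbed hl τ) (by rcases τ with τ | i <;> rfl)
    rw [show paramFamily L k n w b (layerEmbed hl τ) = fun ω => layerParam k n
      (fun l i j β => w l i j β ω) (fun l i => b l i ω) l τ from
        funext fun ω => paramFamily_layerEmbed hl τ ω] at h2
    exact h2
  · refine Measurable.comap_le (@measurable_pi_lambda _ _ _ (_) _ _ fun j =>
      @measurable_pi_lambda _ _ _ (_) _ _ fun p => ?_)
    refine @measurable_activation d φ k n Ω (_) hφ w b (inputLayer (x p.1)) l ?_ ?_ j j.2 p.2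
    · exact fun l' hl' i hi j hj β hβ => hmeas {τ | paramLayer τ < l}
        (Sum.inl ⟨⟨l', by omega⟩, ⟨i, hi⟩, ⟨j, hj⟩, ⟨β, hβ⟩⟩) hl'
    · exact fun l' hl' i hi => hmeas {τ | paramLayer τ < l}
        (Sum.inr ⟨⟨l', by omega⟩, ⟨i, hi⟩⟩) hl'

end Prior

/-! ### Convergence in probability of the empirical covariances -/

/-- Convergence in probability to a constant, along a sequence of probability spaces, implies
convergence of the expectation of a function bounded by one and continuous at the constant. -/
lemma tendsto_integral_of_tendsto_measure_notMem {E : Type*} [TopologicalSpace E] {Ω : ℕ → Type*}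
    [∀ t, MeasurableSpace (Ω t)] {P : (t : ℕ) → Measure (Ω t)} [∀ t, IsProbabilityMeasure (P t)]
    {X : (t : ℕ) → Ω t → E} {c : E}
    (hX : ∀ U ∈ 𝓝 c, Tendsto (fun t => P t {ω | X t ω ∉ U}) atTop (𝓝 0)) {f : E → ℂ}
    (hf : ContinuousAt f c) (hfX : ∀ t ω, ‖f (X t ω)‖ ≤ 1) (hfc : ‖f c‖ ≤ 1)
    (hm : ∀ t, AEStronglyMeasurable (fun ω => f (X t ω)) (P t)) :
    Tendsto (fun t => ∫ ω, f (X t ω) ∂(P t)) atTop (𝓝 (f c)) := by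
  rw [tendsto_iff_edist_tendsto_0, ENNReal.tendsto_nhds_zero]
  intro ε hε
  have hε2 : 0 < ε / 2 := ENNReal.half_pos hε.ne'
  have hU : {K | edist (f K) (f c) < ε / 2} ∈ 𝓝 c := hf (Metric.eball_mem_nhds (f c) hε2)
  have h2 : Tendsto (fun t => 2 * P t {ω | X t ω ∉ {K | edist (f K) (f c) < ε / 2}}) atTop
      (𝓝 0) := by
    simpa using ENNReal.Tendsto.const_mul (hX _ hU) (Or.inr (by norm_num : (2 : ENNReal) ≠ ⊤))
  filter_upwards [ENNReal.tendsto_nhds_zero.1 h2 (ε / 2) hε2] with t ht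
  have hi : Integrable (fun ω => f (X t ω)) (P t) :=
    Integrable.of_bound (hm t) 1 (ae_of_all _ (hfX t))
  have e1 : ∫ ω, f (X t ω) ∂(P t) - f c = ∫ ω, (f (X t ω) - f c) ∂(P t) := by
    rw [integral_sub hi (integrable_const _)]
    simp
  rw [edist_eq_enorm_sub, e1]
  refine (enorm_integral_le_lintegral_enorm _).trans ?_
  set bad := {ω | X t ω ∉ {K | edist (f K) (f c) < ε / 2}} with hbad
  have hle : ∀ ω, ‖f (X t ω) - f c‖ₑ ≤ ε / 2 + 2 * bad.indicator 1 ω := by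
    intro ω
    by_cases hω : ω ∈ bad
    · rw [Set.indicator_of_mem hω, Pi.one_apply, mul_one]
      refine le_add_of_nonneg_of_le (zero_le) ?_
      have h3 : ‖f (X t ω) - f c‖ ≤ 2 := (norm_sub_le _ _).trans (by linarith [hfX t ω])
      rw [← ofReal_norm]
      exact (ENNReal.ofReal_le_ofReal h3).trans (by simp)
    · rw [Set.indicator_of_notMem hω, mul_zero, add_zero, ← edist_eq_enorm_sub]
      exact (not_not.1 hω : edist (f (X t ω)) (f c) < ε / 2).le
  calc ∫⁻ ω, ‖f (X t ω) - f c‖ₑ ∂(P t) ≤ ∫⁻ ω, (ε / 2 + 2 * bad.indicator 1 ω) ∂(P t) :=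
        lintegral_mono hle
    _ = ε / 2 + 2 * ∫⁻ ω, bad.indicator 1 ω ∂(P t) := by
        rw [lintegral_add_left measurable_const, lintegral_const_mul' _ _ (by norm_num)]
        simp
    _ ≤ ε / 2 + ε / 2 := by
        gcongr
        refine le_trans ?_ ht
        gcongr
        exact lintegral_indicator_one_le _
    _ = ε := ENNReal.add_halves ε

lemma exists_forall_abs_sub_lt_mem {ι : Type*} [Fintype ι] {K : Matrix ι ι ℝ}
    {U : Set (Matrix ι ι ℝ)} (hU : U ∈ 𝓝 K) :
    ∃ ε > 0, ∀ K' : Matrix ι ι ℝ, (∀ p q, |K' p q - K p q| < ε) → K' ∈ U := by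
  obtain ⟨ε, hε, h⟩ := (Metric.mem_nhds_iff (α := ι → ι → ℝ)).1 hU
  exact ⟨ε, hε, fun K' hK' => h ((dist_pi_lt_iff (X := fun _ => ι → ℝ) hε).2 fun p =>
    (dist_pi_lt_iff hε).2 fun q => hK' p q)⟩

lemma continuous_empiricalCov {ι : Type*} {N : ℕ} :
    Continuous (empiricalCov : (Fin N → ι → ℝ) → Matrix ι ι ℝ) := by
  refine continuous_matrix fun p q => ?_
  simp only [empiricalCov, Matrix.of_apply]
  fun_prop

section Single

variable {Ω : Type*} [MeasurableSpace Ω] {P : Measure Ω} [IsProbabilityMeasure P] {L k : ℕ}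
  {n : ℕ → ℕ} {v : ℤ → ℝ≥0} {σw σb : ℝ≥0} {w : ℕ → ℕ → ℕ → ℤ → Ω → ℝ} {b : ℕ → ℕ → Ω → ℝ}
  {𝒳 : Type*} {d n₀ : ℕ} {φ : ℝ → ℝ}

lemma measurable_layerActivation (hw : ∀ l i j β, Measurable (w l i j β))
    (hb : ∀ l i, Measurable (b l i)) (hφ : Measurable φ) (x : 𝒳 → Fin n₀ → ZMod d → ℝ) (l : ℕ) :
    Measurable fun ω => layerActivation φ k n x (fun l i j β => w l i j β ω)
      (fun l i => b l i ω) l :=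
  measurable_pi_lambda _ fun j => measurable_pi_lambda _ fun p =>
    measurable_activation hφ _ l (fun _ _ _ _ _ _ _ _ => hw _ _ _ _) (fun _ _ _ _ => hb _ _) j
      j.2 p.2

lemma measurable_topPreactivation [NeZero d] (hw : ∀ l i j β, Measurable (w l i j β))
    (hb : ∀ l i, Measurable (b l i)) (hφ : Measurable φ) (x : 𝒳 → Fin n₀ → ZMod d → ℝ) (m : ℕ) :
    Measurable fun ω => topPreactivation φ k L m n x (fun l i j β => w l i j β ω)
      (fun l i => b l i ω) := by
  unfold topPreactivation
  refine (WithLp.measurable_toLp 2 _).comp (measurable_pi_lambda _ fun p => ?_)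
  refine Measurable.add ?_ (hb _ _)
  exact Finset.measurable_sum _ fun j hj => Finset.measurable_sum _ fun β _ =>
    (hw _ _ _ _).mul (measurable_activation hφ _ L (fun _ _ _ _ _ _ _ _ => hw _ _ _ _)
      (fun _ _ _ _ => hb _ _) j (Finset.mem_range.1 hj) _)

variable [Fintype 𝒳] [DecidableEq 𝒳] [NeZero d]

lemma IsGaussianPrior.charFun_map_topPreactivation (h : IsGaussianPrior P L k n v σw σb w b)
    (hw : ∀ l i j β, Measurable (w l i j β)) (hb : ∀ l i, Measurable (b l i))
    (hφ : Measurable φ) (x : 𝒳 → Fin n₀ → ZMod d → ℝ) {m : ℕ} (hm : n (L + 1) = m)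
    (s : EuclideanSpace ℝ ((𝒳 × ZMod d) × Fin m)) :
    charFun (P.map fun ω => topPreactivation φ k L m n x (fun l i j β => w l i j β ω)
      (fun l i => b l i ω)) s =
    ∫ ω, charFun (multivariateGaussian 0 (affineMap k v σw σb
      (empiricalCov (layerActivation φ k n x (fun l i j β => w l i j β ω)
        (fun l i => b l i ω) L)) ⊗ₖ (1 : Matrix (Fin m) (Fin m) ℝ))) s ∂P := by
  subst hm
  simp only [← flatten_layerOut]
  exact charFun_map_flatten_layerOut (measurable_layerActivation hw hb hφ x L)
    (h.hasLaw_layerParam le_rfl) (h.indepFun_layerActivation hw hb x hφ le_rfl) s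

/-- The induction step for a single network. Suppose that for all `K` in a set `V` the empirical
mean of `φ(u_p) φ(u_q)` over independent samples `u` of `N(0, 𝒜 K)` is `ε`-close to `c` up to
probability `δ`. Then the entry `(p, q)` of the empirical covariance of layer `l + 1` is `ε`-close
to `c` up to probability `δ` plus the probability that the empirical covariance of layer `l` is
not in `V`. -/
lemma IsGaussianPrior.measure_empiricalCov_succ_le (h : IsGaussianPrior P L k n v σw σb w b)
    (hw : ∀ l i j β, Measurable (w l i j β)) (hb : ∀ l i, Measurable (b l i))
    (hφ : Measurable φ) (x : 𝒳 → Fin n₀ → ZMod d → ℝ) {l : ℕ} (hl : l ≤ L)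
    (p q : 𝒳 × ZMod d) {ε c : ℝ} {δ : ENNReal} {V : Set (Matrix (𝒳 × ZMod d) (𝒳 × ZMod d) ℝ)}
    (hV : ∀ K ∈ V, K.PosSemidef → Measure.pi (fun _ : Fin (n (l + 1)) =>
      multivariateGaussian 0 (affineMap k v σw σb K))
        {u | ε ≤ |1 / (n (l + 1) : ℝ) * ∑ i, φ (u i p) * φ (u i q) - c|} ≤ δ) :
    P {ω | ε ≤ |empiricalCov (layerActivation φ k n x (fun l i j β => w l i j β ω)
      (fun l i => b l i ω) (l + 1)) p q - c|} ≤
    δ + P {ω | empiricalCov (layerActivation φ k n x (fun l i j β => w l i j β ω)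
      (fun l i => b l i ω) l) ∉ V} := by
  set T : Set (Fin (n (l + 1)) → EuclideanSpace ℝ (𝒳 × ZMod d)) :=
    {u | ε ≤ |1 / (n (l + 1) : ℝ) * ∑ i, φ (u i p) * φ (u i q) - c|} with hT
  have hTm : MeasurableSet T := by
    refine measurableSet_le measurable_const ?_
    fun_prop
  set Y := fun ω => layerActivation φ k n x (fun l i j β => w l i j β ω) (fun l i => b l i ω) l
    with hY
  have h1 := measure_layerOut_mem (measurable_layerActivation hw hb hφ x l)
    (h.hasLaw_layerParam hl) (h.indepFun_layerActivation hw hb x hφ hl) hTm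
  have h2 : {ω | ε ≤ |empiricalCov (layerActivation φ k n x (fun l i j β => w l i j β ω)
      (fun l i => b l i ω) (l + 1)) p q - c|} = {ω | layerOut (Y ω)
        (layerParam k n (fun l i j β => w l i j β ω) (fun l i => b l i ω) l) ∈ T} := by
    ext ω
    simp only [hT, hY, empiricalCov, Matrix.of_apply, layerActivation_succ, Set.mem_ofPred_eq]
  rw [h2, h1]
  set bad := {ω | empiricalCov (Y ω) ∉ V} with hbad
  calc _ ≤ ∫⁻ ω, (δ + bad.indicator 1 ω) ∂P := by
        refine lintegral_mono fun ω => ?_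
        by_cases hω : ω ∈ bad
        · rw [Set.indicator_of_mem hω]
          exact le_add_of_nonneg_of_le (zero_le) prob_le_one
        · rw [Set.indicator_of_notMem hω, add_zero]
          exact hV _ (not_not.1 hω) (posSemidef_empiricalCov _)
    _ = δ + ∫⁻ ω, bad.indicator 1 ω ∂P := by
        rw [lintegral_add_left measurable_const]
        simp
    _ ≤ δ + P bad := by
        gcongr
        exact lintegral_indicator_one_le _

end Single

/-- The empirical covariances of all layers converge in probability to the compositional
kernel. -/
lemma tendsto_measure_empiricalCov_notMem {d k L n₀ : ℕ} [NeZero d] {𝒳 : Type*} [Fintype 𝒳]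
    [DecidableEq 𝒳] (x : 𝒳 → Fin n₀ → ZMod d → ℝ) {v : ℤ → ℝ≥0} {σw σb : ℝ≥0} {φ : ℝ → ℝ}
    {A B : ℝ} (hc : Continuous φ) (hbd : ∀ u, |φ u| ≤ A * Real.exp (B * |u|))
    {n : ℕ → ℕ → ℕ} (hn_in : ∀ t, n t 0 = n₀)
    (hn : ∀ l ∈ Finset.Icc 1 L, Tendsto (fun t => n t l) atTop atTop)
    {Ω : ℕ → Type*} [∀ t, MeasurableSpace (Ω t)] {P : (t : ℕ) → Measure (Ω t)}
    [∀ t, IsProbabilityMeasure (P t)]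
    {w : (t : ℕ) → ℕ → ℕ → ℕ → ℤ → Ω t → ℝ} {b : (t : ℕ) → ℕ → ℕ → Ω t → ℝ}
    (hw : ∀ t l i j β, Measurable (w t l i j β)) (hb : ∀ t l i, Measurable (b t l i))
    (h : ∀ t, IsGaussianPrior (P t) L k (n t) v σw σb (w t) (b t)) (l : ℕ) (hl : l ≤ L) :
    ∀ U ∈ 𝓝 (limitKernel φ k v σw σb x l), Tendsto (fun t => P t {ω | empiricalCov
      (layerActivation φ k (n t) x (fun l i j β => w t l i j β ω) (fun l i => b t l i ω) l) ∉ U})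
      atTop (𝓝 0) := by
  induction l with
  | zero =>
    intro U hU
    have hmem : inputCov x ∈ U := mem_of_mem_nhds hU
    simp [empiricalCov_layerActivation_zero _ _ _ (hn_in _), hmem]
  | succ l ih =>
    have hl' : l ≤ L := (Nat.le_succ l).trans hl
    intro U hU
    obtain ⟨ε, hε, hεU⟩ := exists_forall_abs_sub_lt_mem hU
    have hpsd := posSemidef_affineMap k v σw σb
      (posSemidef_limitKernel k v σw σb hc hbd x l)
    -- each entry converges in probability
    have hentry : ∀ p q, Tendsto (fun t => P t {ω | ε ≤ |empiricalCov
        (layerActivation φ k (n t) x (fun l i j β => w t l i j β ω) (fun l i => b t l i ω)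
          (l + 1)) p q - limitKernel φ k v σw σb x (l + 1) p q|}) atTop (𝓝 0) := by
      intro p q
      obtain ⟨C, hC⟩ := exists_deviation_le hc hbd hpsd p q hε
      have hV := (continuous_affineMap k v σw σb).tendsto _ (eventually_nhdsWithin_iff.1 hC)
      have hnt := hn (l + 1) (Finset.mem_Icc.2 ⟨by omega, hl⟩)
      have hlim : Tendsto (fun t => ENNReal.ofReal (C / (n t (l + 1) : ℝ))) atTop (𝓝 0) := by
        have h1 : Tendsto (fun t => C / (n t (l + 1) : ℝ)) atTop (𝓝 0) :=
          tendsto_const_nhds.div_atTop (tendsto_natCast_atTop_atTop.comp hnt)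
        simpa using ENNReal.tendsto_ofReal h1
      refine tendsto_of_tendsto_of_tendsto_of_le_of_le' tendsto_const_nhds
        (by have h1 := hlim.add (ih hl' _ hV); rwa [add_zero] at h1)
        (Eventually.of_forall fun t => zero_le) ?_
      filter_upwards [hnt.eventually_gt_atTop 0] with t ht
      refine (h t).measure_empiricalCov_succ_le (hw t) (hb t) hc.measurable x hl' p q
        fun K hK hKp => ?_
      rw [limitKernel_succ]
      exact hK (posSemidef_affineMap k v σw σb hKp) _ ht
    have hsum : Tendsto (fun t => ∑ p, ∑ q, P t {ω | ε ≤ |empiricalCov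
        (layerActivation φ k (n t) x (fun l i j β => w t l i j β ω) (fun l i => b t l i ω)
          (l + 1)) p q - limitKernel φ k v σw σb x (l + 1) p q|}) atTop (𝓝 0) := by
      simpa using tendsto_finsetSum Finset.univ fun p _ =>
        tendsto_finsetSum Finset.univ fun q _ => hentry p q
    refine tendsto_of_tendsto_of_tendsto_of_le_of_le tendsto_const_nhds hsum
      (fun t => zero_le) fun t => ?_
    refine le_trans (measure_mono fun ω hω => ?_) ((measure_iUnion_fintype_le _ _).trans
      (Finset.sum_le_sum fun p _ => measure_iUnion_fintype_le _ _))
    by_contra hcon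
    simp only [Set.mem_iUnion, Set.mem_ofPred_eq, not_exists, not_le] at hcon
    exact hω (hεU _ fun p q => hcon p q)

end CNN

/-! ### Convergence in distribution of the top-layer pre-activations -/

theorem mainTheorem1
    -- number of pixels, half filter size, depth, numbers of input and output channels
    (d k L n₀ m : ℕ) [NeZero d]
    -- the finite collection of inputs
    {𝒳 : Type*} [Fintype 𝒳] [DecidableEq 𝒳] (x : 𝒳 → Fin n₀ → ZMod d → ℝ)
    -- variance profile of the filters, weight and bias standard deviations
    (v : ℤ → ℝ≥0) (hv : ∑ β ∈ CNN.offsets k, v β = 1) (σw σb : ℝ≥0)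
    -- the nonlinearity
    (φ : ℝ → ℝ) (hφ : CNN.IsAbsolutelyContinuous φ) (hφ' : CNN.IsExpBounded (deriv φ))
    -- the widths `n t l` of the layers of the `t`-th network, all hidden ones tending to infinity
    (n : ℕ → ℕ → ℕ) (hn_in : ∀ t, n t 0 = n₀) (hn_out : ∀ t, n t (L + 1) = m)
    (hn : ∀ l ∈ Finset.Icc 1 L, Tendsto (fun t => n t l) atTop atTop)
    -- the random parameters of the `t`-th network
    {Ω : ℕ → Type*} [∀ t, MeasurableSpace (Ω t)] (P : (t : ℕ) → Measure (Ω t))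
    [∀ t, IsProbabilityMeasure (P t)]
    (w : (t : ℕ) → ℕ → ℕ → ℕ → ℤ → Ω t → ℝ) (b : (t : ℕ) → ℕ → ℕ → Ω t → ℝ)
    (hprior : ∀ t, CNN.IsGaussianPrior (P t) L k (n t) v σw σb (w t) (b t)) :
    -- the compositional kernel is well defined
    (∀ l < L, ∀ p q : 𝒳 × ZMod d,
      Integrable (fun u : EuclideanSpace ℝ (𝒳 × ZMod d) => φ (u p) * φ (u q))
        (multivariateGaussian 0
          (CNN.affineMap k v σw σb (CNN.limitKernel φ k v σw σb x l)))) ∧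
    (∀ l ≤ L, (CNN.limitKernel φ k v σw σb x l).PosSemidef ∧
      (CNN.affineMap k v σw σb (CNN.limitKernel φ k v σw σb x l)).PosSemidef) ∧
    -- convergence in distribution of the top-layer pre-activations
    TendstoInDistribution
      (fun (t : ℕ) (ϑ : Ω t) => CNN.topPreactivation φ k L m (n t) x
        (fun l i j β => w t l i j β ϑ) (fun l i => b t l i ϑ))
      atTop
      (id : EuclideanSpace ℝ ((𝒳 × ZMod d) × Fin m) → _)
      P
      (multivariateGaussian 0
        (CNN.affineMap k v σw σb (CNN.limitKernel φ k v σw σb x L) ⊗ₖ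
          (1 : Matrix (Fin m) (Fin m) ℝ))) := by
  have hc := hφ.continuous
  obtain ⟨A, B, hbd⟩ := hφ.exists_abs_le_exp hφ'
  have hK := CNN.posSemidef_limitKernel k v σw σb hc hbd x
  have hAK := fun l => CNN.posSemidef_affineMap k v σw σb (hK l)
  refine ⟨fun l _ p q => CNN.integrable_mul_eval hc hbd (hAK l) p q,
    fun l _ => ⟨hK l, hAK l⟩, ?_⟩
  -- measurable modifications of the parameters, which change the output only on a null set
  choose w' b' hw' hb' hww' hbb' hprior' using fun t => (hprior t).exists_measurable
  have hmeas := fun t => CNN.measurable_topPreactivation (L := L) (k := k) (n := n t) (hw' t)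
    (hb' t) hc.measurable x m
  have hae : ∀ t, (fun ϑ => CNN.topPreactivation φ k L m (n t) x
      (fun l i j β => w' t l i j β ϑ) (fun l i => b' t l i ϑ)) =ᵐ[P t] fun ϑ =>
      CNN.topPreactivation φ k L m (n t) x
        (fun l i j β => w t l i j β ϑ) (fun l i => b t l i ϑ) := by
    intro t
    have h1 : ∀ᵐ ϑ ∂(P t), ∀ l ≤ L, ∀ i < n t (l + 1), ∀ j < n t l, ∀ β ∈ CNN.offsets k,
        w t l i j β ϑ = w' t l i j β ϑ := by
      simp only [ae_all_iff]
      exact hww' t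
    have h2 : ∀ᵐ ϑ ∂(P t), ∀ l ≤ L, ∀ i < n t (l + 1), b t l i ϑ = b' t l i ϑ := by
      simp only [ae_all_iff]
      exact hbb' t
    filter_upwards [h1, h2] with ϑ h1 h2
    ext p
    exact (CNN.preactivation_congr _ L h1 h2 p.2 ((hn_out t).symm ▸ p.2.2) p.1.2).symm
  refine TendstoInDistribution.congr hae (ae_eq_refl _)
    ⟨fun t => (hmeas t).aemeasurable, aemeasurable_id, ?_⟩
  refine ProbabilityMeasure.tendsto_of_tendsto_charFun fun s => ?_
  simp only [ProbabilityMeasure.coe_mk, Measure.map_id]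
  have hpsd : ∀ {K : Matrix (𝒳 × ZMod d) (𝒳 × ZMod d) ℝ}, K.PosSemidef →
      (CNN.affineMap k v σw σb K ⊗ₖ (1 : Matrix (Fin m) (Fin m) ℝ)).PosSemidef := fun hK =>
    (CNN.posSemidef_affineMap k v σw σb hK).kronecker Matrix.PosSemidef.one
  -- the Gaussian characteristic function at `s`, by its explicit formula, which is continuous in
  -- all matrices `K`
  set g : Matrix (𝒳 × ZMod d) (𝒳 × ZMod d) ℝ → ℂ := fun K => Complex.exp
    ((inner ℝ s (0 : EuclideanSpace ℝ ((𝒳 × ZMod d) × Fin m)) : ℝ) * Complex.I -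
      ((s.ofLp ⬝ᵥ (CNN.affineMap k v σw σb K ⊗ₖ
        (1 : Matrix (Fin m) (Fin m) ℝ)).mulVec s.ofLp : ℝ) : ℂ) / 2) with hg
  have hgK : ∀ {K : Matrix (𝒳 × ZMod d) (𝒳 × ZMod d) ℝ}, K.PosSemidef →
      charFun (multivariateGaussian 0 (CNN.affineMap k v σw σb K ⊗ₖ
        (1 : Matrix (Fin m) (Fin m) ℝ))) s = g K := fun hK =>
    charFun_multivariateGaussian (hpsd hK) s
  have hg1 : ∀ {K : Matrix (𝒳 × ZMod d) (𝒳 × ZMod d) ℝ}, K.PosSemidef → ‖g K‖ ≤ 1 := fun hK => by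
    rw [← hgK hK]
    exact norm_charFun_le_one s
  have hgc : Continuous g := by
    have h1 : Continuous fun K : Matrix (𝒳 × ZMod d) (𝒳 × ZMod d) ℝ =>
        CNN.affineMap k v σw σb K ⊗ₖ (1 : Matrix (Fin m) (Fin m) ℝ) :=
      continuous_matrix fun p q => ((CNN.continuous_affineMap k v σw σb).matrix_elem _ _).mul
        continuous_const
    have h2 : Continuous fun K : Matrix (𝒳 × ZMod d) (𝒳 × ZMod d) ℝ =>
        s.ofLp ⬝ᵥ (CNN.affineMap k v σw σb K ⊗ₖ
          (1 : Matrix (Fin m) (Fin m) ℝ)).mulVec s.ofLp :=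
      continuous_const.dotProduct (h1.matrix_mulVec continuous_const)
    rw [hg]
    fun_prop
  rw [hgK (hK L)]
  simp only [fun t => (hprior' t).charFun_map_topPreactivation (hw' t) (hb' t) hc.measurable x
    (hn_out t) s, hgK (CNN.posSemidef_empiricalCov _)]
  refine CNN.tendsto_integral_of_tendsto_measure_notMem
    (CNN.tendsto_measure_empiricalCov_notMem x hc hbd hn_in hn hw' hb' hprior' L le_rfl)
    hgc.continuousAt (fun t ω => hg1 (CNN.posSemidef_empiricalCov _)) (hg1 (hK L)) fun t => ?_
  exact ((hgc.comp CNN.continuous_empiricalCov).measurable.comp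
    (CNN.measurable_layerActivation (hw' t) (hb' t) hc.measurable x L)).aestronglyMeasurable
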